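/- **Definitions.** A *promise template* $\Gamma$ over finite domains $D,E$ with a finite set $I$ of relation symbols of arities $\mathrm{ar}_i$ consists of relations $P_i\subseteq D^{\mathrm{ar}_i}$, $Q_i\subseteq E^{\mathrm{ar}_i}$ $(i\in I)$ and a map $\phi:D\to E$ with $\phi(P_i)\subseteq Q_i$ for all $i$ (maps are applied coordinatewise). An instance is a conjunction of constraints $\Psi(x_1,\dots,x_n)=\bigwedge_{j\in J}i_j(x_{j_1},\dots,x_{j_{\mathrm{ar}_{i_j}}})$; $\Psi_P$ and $\Psi_Q$ denote $\Psi$ with each symbol $i$ read as $P_i$, respectively $Q_i$. $\mathrm{PCSP}(\Gamma)$ is the promise problem: accept if $\Psi_P$ is satisfiable, reject if $\Psi_Q$ is not satisfiable. $\mathrm{Search}$-$\mathrm{PCSP}(\Gamma)$ asks, given that $\Psi_P$ is satisfiable, for a satisfying assignment of $\Psi_Q$. For a subring $A\subset\mathbb R$ and a set $S\subseteq\mathbb Z^N$, let $\mathrm{Conv}_A(S)$ be the set of points of $A^N$ that lie in the real convex hull of $S$. For $k\ge 1$ let $\mathrm{LP}_{A^k}$ be the family of all relations $\mathrm{Conv}_A(S)\subseteq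 (A^k)^\ell$ with $\ell\ge1$ and $S\subset\mathbb Z^{k\ell}$ finite. $\Gamma$ *sandwiches* $\mathrm{LP}_{A^k}$ via $g:D\to\mathbb Z^k$ and $h:A^k\to E$ if there are relations $R_i\in\mathrm{LP}_{A^k}$ of arity $\mathrm{ar}_i$ such that $g(P_i)\subseteq R_i$ and $h(R_i)\subseteq Q_i$ for all $i\in I$. A solution over $A$ of the *Basic LP* of $\Psi$ is a tuple $(v_1,\dots,v_n)\in(A^k)^n$ such that each $v_i\in\mathrm{Conv}_A(g(D))$ and $(v_{j_1},\dots,v_{j_{\mathrm{ar}_{i_j}}})\in\mathrm{Conv}_A(g(P_{i_j}))$ for each constraint of $\Psi$. Let the elements of $A$ be represented by bit strings (each element has at least one representation); sizes are lengths of representations. $A$ is *efficiently computable* if: a representation of an integer $n$, of size polynomial in the bit length of $n$, can be computed in polynomial time; there is a polynomial $s$ with $2^{-s(\ell)}<a<2^{s(\ell)}$ for every $a>0$ with a representation of size $\ell$; $+,-,\times,=,<$ are computable in polynomial time on representations; and there is a constant $C$ such that the representation computed for $a\circ b$, $\circ\in\{+,-,\times\}$, has size at most $C$ times the sum of the sizes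 of the given representations of $a$ and $b$. $A$ is *LP-solvable* if it is efficiently computable and there is a polynomial-time algorithm that, given $M\in\mathbb Z^{m\times n}$ and $b\in\mathbb Z^m$ (time polynomial in $n$, $m$ and the bit size of $M,b$), outputs some $x\in A^n$ with $Mx\le b$, or reports that none exists. *Polynomial time given oracle access to $h$* refers to a machine that may query an oracle with representations of $a_1,\dots,a_k\in A$ and receives $h(a_1,\dots,a_k)$ in one step; $\mathsf P^h$ is the class of promise problems decided by such a machine in polynomial time. **Theorem.** Let $A\subset\mathbb R$ be an LP-solvable ring, $k\ge1$, and let $\Gamma$ be a finite promise template over finite domains $D,E$. Assume that $\Gamma$ sandwiches $\mathrm{LP}_{A^k}$ via $g:D\to\mathbb Z^k$ and $h:A^k\to E$. Then $\mathrm{PCSP}(\Gamma)\in\mathsf P^h$. Moreover, given oracle access to $h$, $\mathrm{Search}$-$\mathrm{PCSP}(\Gamma)$ is solvable in polynomial time, and there is a polynomial-time algorithm that, on every instance $\Psi$, outputs $(h(v_1),\dots,h(v_n))$ for some solution $(v_1,\dots,v_n)$ over $A$ of the Basic LP of $\Psi$, or rejects if the Basic LP has no solution over $A$. -/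

import Mathlib

/-! Promise CSPs, bit representations of subrings of the reals, LP-solvability, and polynomial
time with an oracle. -/

noncomputable section

namespace PromiseCSP

/-! ### Deterministic multi-stack machines with an oracle

A machine has a finite control and finitely many stacks of bits (two stacks are one tape of a
Turing machine). Every instruction costs one step. -/

/-- Instructions of a machine with stacks `K` and control states `Q`; the last argument gives the
next state. `pop` branches on the removed bit (`none` if the stack is empty). -/
inductive Instr (K Q : Type) : Type
  | push (k : K) (b : Bool) (next : Q)
  | pop (k : K) (next : Option Bool → Q)
  | query (next : Q)
  | halt

structure Machine where
  /-- stacks -/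
  K : Type
  /-- control states -/
  Q : Type
  decK : DecidableEq K
  finK : Fintype K
  finQ : Fintype Q
  /-- input stack -/
  inp : K
  /-- output stack -/
  out : K
  /-- stack on which oracle queries are written -/
  qry : K
  /-- stack on which oracle answers are received -/
  ans : K
  start : Q
  instr : Q → Instr K Q

attribute [instance] Machine.decK Machine.finK Machine.finQ

/-- An oracle answers bit strings by bit strings. -/
abbrev Oracle : Type := List Bool → List Bool

namespace Machine

/-- A configuration; the head of a list is the top of the stack. -/
structure Cfg (M : Machine) where
  state : M.Q
  stk : M.K → List Bool

/-- One step. A query consumes the query stack and replaces the answer stack by the oracle's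
answer. A halted configuration does not change. -/
def step (M : Machine) (O : Oracle) (c : M.Cfg) : M.Cfg :=
  match M.instr c.state with
  | .push k b q => ⟨q, Function.update c.stk k (b :: c.stk k)⟩
  | .pop k q => ⟨q (c.stk k).head?, Function.update c.stk k (c.stk k).tail⟩
  | .query q =>
      ⟨q, Function.update (Function.update c.stk M.qry []) M.ans (O (c.stk M.qry))⟩
  | .halt => c

/-- The initial configuration: the input is on the input stack, all other stacks are empty. -/
def initial (M : Machine) (x : List Bool) : M.Cfg :=
  ⟨M.start, Function.update (fun _ => []) M.inp x⟩

/-- On input `x` and with oracle `O`, the machine halts within `t` steps with output `y`. -/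
def Outputs (M : Machine) (O : Oracle) (x y : List Bool) (t : ℕ) : Prop :=
  M.instr ((M.step O)^[t] (M.initial x)).state = Instr.halt ∧
    ((M.step O)^[t] (M.initial x)).stk M.out = y

/-- The machine never uses its oracle. -/
def OracleFree (M : Machine) : Prop :=
  ∀ q q', M.instr q ≠ Instr.query q'

end Machine

/-- The search problem "given `a`, encoded by `enc a`, output some `y` with `R a y`" is solved in
polynomial time by a machine without oracle. -/
def PolyTime {α : Type*} (enc : α → List Bool) (R : α → List Bool → Prop) : Prop :=
  ∃ (M : Machine) (p : Polynomial ℕ), M.OracleFree ∧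
    ∀ a, ∃ y, M.Outputs (fun _ => []) (enc a) y (p.eval (enc a).length) ∧ R a y

/-- The search problem "given `a`, encoded by `enc a`, output some `y` with `R a y`" is solved in
polynomial time by one machine that may use an oracle, whichever oracle of the family `𝒪` it is
given. -/
def OraclePolyTime (𝒪 : Set Oracle) {α : Type*} (enc : α → List Bool)
    (R : α → List Bool → Prop) : Prop :=
  ∃ (M : Machine) (p : Polynomial ℕ), ∀ O ∈ 𝒪,
    ∀ a, ∃ y, M.Outputs O (enc a) y (p.eval (enc a).length) ∧ R a y

/-- A promise language: the inputs to be accepted and those to be rejected. -/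
structure PromiseLanguage where
  yes : Set (List Bool)
  no : Set (List Bool)

/-- The promise languages decided in polynomial time by one machine, whichever oracle of the
family `𝒪` it is given. The machine accepts or rejects by the first bit of its output. -/
def OracleP (𝒪 : Set Oracle) : Set PromiseLanguage :=
  {L | ∃ (M : Machine) (p : Polynomial ℕ), ∀ O ∈ 𝒪, ∀ x ∈ L.yes ∪ L.no,
    ∃ y, M.Outputs O x y (p.eval x.length) ∧
      (x ∈ L.yes → y.head? = some true) ∧ (x ∈ L.no → y.head? = some false)}

/-! ### Encodings by bit strings -/

/-- Unary code of a natural number. -/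
def encNat (n : ℕ) : List Bool := List.replicate n true ++ [false]

/-- Self-delimiting code of a bit string: every bit is preceded by `true`, and `false` ends. -/
def encStr (w : List Bool) : List Bool := w.flatMap (fun b => [true, b]) ++ [false]

/-- Binary code of an integer: the sign, then the binary digits of the absolute value. -/
def encInt (z : ℤ) : List Bool := decide (z < 0) :: encStr (Nat.bits z.natAbs)

/-- Code of an element of a finite set: its position in a fixed enumeration. -/
def encFin {E : Type*} [Fintype E] (e : E) : List Bool := encNat (Fintype.equivFin E e)

/-! ### Subrings of the reals with a bit representation -/

/-- A representation of the elements of `A` by bit strings. Every element has at least one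
representation; it may have several. -/
structure BitRep (A : Subring ℝ) where
  /-- the bit strings that represent an element -/
  Word : Set (List Bool)
  val : Word → A
  surj : Function.Surjective val

namespace BitRep

variable {A : Subring ℝ}

/-- Code of a tuple of representations. -/
def encTuple (ρ : BitRep A) {n : ℕ} (x : Fin n → ρ.Word) : List Bool :=
  (List.ofFn x).flatMap (fun w => encStr w.1)

def encPair (ρ : BitRep A) (uv : ρ.Word × ρ.Word) : List Bool :=
  encStr uv.1.1 ++ encStr uv.2.1

/-- A binary operation of `A` is computable in polynomial time on representations, and the
representation of the result is at most `C` times as long as those of the arguments together. -/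
def OpComputable (ρ : BitRep A) (C : ℕ) (op : A → A → A) : Prop :=
  PolyTime ρ.encPair (fun uv y => ∃ w : ρ.Word, y = w.1 ∧ ρ.val w = op (ρ.val uv.1) (ρ.val uv.2) ∧
    w.1.length ≤ C * (uv.1.1.length + uv.2.1.length))

/-- A binary relation on `A` is decidable in polynomial time on representations. -/
def RelDecidable (ρ : BitRep A) (r : A → A → Prop) : Prop :=
  PolyTime ρ.encPair (fun uv y => (r (ρ.val uv.1) (ρ.val uv.2) ∧ y = [true]) ∨
    (¬ r (ρ.val uv.1) (ρ.val uv.2) ∧ y = [false]))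

/-- `A`, with the given representation, is an efficiently computable subring of `ℝ`. -/
structure EfficientlyComputable (ρ : BitRep A) : Prop where
  int : ∃ s : Polynomial ℕ, PolyTime encInt (fun (n : ℤ) y =>
    ∃ w : ρ.Word, y = w.1 ∧ ρ.val w = (n : A) ∧ w.1.length ≤ s.eval (Nat.size n.natAbs))
  bounds : ∃ s : Polynomial ℕ, ∀ w : ρ.Word, 0 < (ρ.val w : ℝ) →
    (ρ.val w : ℝ) < 2 ^ s.eval w.1.length ∧ ((2 : ℝ) ^ s.eval w.1.length)⁻¹ < (ρ.val w : ℝ)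
  ops : ∃ C : ℕ, ρ.OpComputable C (· + ·) ∧ ρ.OpComputable C (· - ·) ∧ ρ.OpComputable C (· * ·)
  eq : ρ.RelDecidable (· = ·)
  lt : ρ.RelDecidable (· < ·)

end BitRep

/-- A system of linear inequalities `M x ≤ b` with integer coefficients. -/
structure IntSystem where
  m : ℕ
  n : ℕ
  M : Matrix (Fin m) (Fin n) ℤ
  b : Fin m → ℤ

namespace IntSystem

/-- The code contains `m` and `n` in unary and every row of `M`, followed by the corresponding
entry of `b`, in binary. -/
def encode (s : IntSystem) : List Bool :=
  encNat s.m ++ encNat s.n ++ (List.ofFn fun i : Fin s.m =>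
    (List.ofFn fun j : Fin s.n => encInt (s.M i j)).flatten ++ encInt (s.b i)).flatten

/-- `x` is a solution of the system, with entries in `A`. -/
def IsSolution (s : IntSystem) {A : Subring ℝ} (x : Fin s.n → A) : Prop :=
  ∀ i, ∑ j, (s.M i j : ℝ) * (x j : ℝ) ≤ (s.b i : ℝ)

end IntSystem

/-- `A`, with the given representation, is LP-solvable: it is efficiently computable, and there is
a polynomial-time algorithm that outputs a solution in `A` of a given integer system of linear
inequalities, or reports (by `[false]`) that there is none. -/
structure LPSolvable {A : Subring ℝ} (ρ : BitRep A) : Prop where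
  efficient : ρ.EfficientlyComputable
  solve : PolyTime IntSystem.encode (fun s y =>
    (∃ x : Fin s.n → ρ.Word, s.IsSolution (fun j => ρ.val (x j)) ∧ y = true :: ρ.encTuple x) ∨
    ((¬ ∃ x : Fin s.n → A, s.IsSolution x) ∧ y = [false]))

/-! ### Promise CSPs -/

/-- `f` is a homomorphism between two templates of the same signature. -/
def IsHom {I D E : Type*} {ar : I → ℕ} (P : ∀ i, Set (Fin (ar i) → D))
    (Q : ∀ i, Set (Fin (ar i) → E)) (f : D → E) : Prop :=
  ∀ i, ∀ x ∈ P i, f ∘ x ∈ Q i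

/-- A promise template over the domains `D` and `E`, with relation symbols `I`. -/
structure PromiseTemplate (I D E : Type*) where
  ar : I → ℕ
  P : ∀ i, Set (Fin (ar i) → D)
  Q : ∀ i, Set (Fin (ar i) → E)
  φ : D → E
  hom : IsHom P Q φ

/-- A formula in the variables `x_1, …, x_n`: a conjunction of constraints, each given by a
relation symbol and the variables to which it is applied. -/
structure Formula {I : Type*} (ar : I → ℕ) where
  n : ℕ
  constraints : List (Σ i : I, Fin (ar i) → Fin n)

namespace Formula

variable {I : Type*} {ar : I → ℕ}

/-- `x` satisfies the formula when the symbols are interpreted by the relations `P`. -/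
def Satisfies {D : Type*} (Ψ : Formula ar) (P : ∀ i, Set (Fin (ar i) → D)) (x : Fin Ψ.n → D) :
    Prop :=
  ∀ c ∈ Ψ.constraints, x ∘ c.2 ∈ P c.1

/-- Code of a formula: the number of variables and then the constraints, each consisting of the
relation symbol and the list of its variables. Each of the `n` variables contributes to the size of
the formula, so `n` is in unary; relative to this, writing the variables in unary changes the size
of the code only polynomially. -/
def encode [Fintype I] (Ψ : Formula ar) : List Bool :=
  encNat Ψ.n ++ Ψ.constraints.flatMap (fun c =>
    true :: (encFin c.1 ++ (List.ofFn fun j => encNat (c.2 j)).flatten)) ++ [false]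

/-- Code of an assignment of elements of a finite set to the variables. -/
def encAssignment {E : Type*} [Fintype E] (Ψ : Formula ar) (y : Fin Ψ.n → E) : List Bool :=
  (List.ofFn fun i => encFin (y i)).flatten

end Formula

namespace PromiseTemplate

variable {I D E : Type*} [Fintype I]

/-- The decision problem `PCSP(Γ)`. -/
def PCSP (Γ : PromiseTemplate I D E) : PromiseLanguage where
  yes := Formula.encode '' {Ψ : Formula Γ.ar | ∃ x, Ψ.Satisfies Γ.P x}
  no := Formula.encode '' {Ψ : Formula Γ.ar | ¬ ∃ y, Ψ.Satisfies Γ.Q y}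

/-- The search problem `Search-PCSP(Γ)`, as a relation between instances and outputs: if `Ψ_P` is
satisfiable, then the output has to be (the bit `true` and) a satisfying assignment of `Ψ_Q`. -/
def SearchPCSP [Fintype E] (Γ : PromiseTemplate I D E) (Ψ : Formula Γ.ar) (out : List Bool) :
    Prop :=
  (∃ x, Ψ.Satisfies Γ.P x) → ∃ y, Ψ.Satisfies Γ.Q y ∧ out = true :: Ψ.encAssignment y

end PromiseTemplate

/-! ### The Basic LP -/

/-- The points of `A^ι` in the real convex hull of a set of integer points. -/
def convIn (A : Subring ℝ) {ι : Type*} (S : Set (ι → ℤ)) : Set (ι → A) :=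
  {v | (fun i => (v i : ℝ)) ∈ convexHull ℝ ((fun (z : ι → ℤ) (i : ι) => (z i : ℝ)) '' S)}

/-- The same for relations: the `ℓ`-tuples of elements of `A^k` that lie, as points of `A^{kℓ}`, in
the real convex hull of a set of integer points. -/
def convRel (A : Subring ℝ) {k l : ℕ} (S : Set (Fin l × Fin k → ℤ)) :
    Set (Fin l → Fin k → A) :=
  {v | Function.uncurry v ∈ convIn A S}

/-- The members of arity `l` of the family `LP_{A^k}`. -/
def LPFamily (A : Subring ℝ) (k l : ℕ) : Set (Set (Fin l → Fin k → A)) :=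
  {R | 1 ≤ l ∧ ∃ S : Set (Fin l × Fin k → ℤ), S.Finite ∧ R = convRel A S}

/-- The inclusion of `ℤ^k` into `A^k`. -/
def intPoint (A : Subring ℝ) {k : ℕ} (z : Fin k → ℤ) : Fin k → A := fun c => (z c : A)

namespace PromiseTemplate

variable {I D E : Type*}

/-- `Γ` sandwiches the family `LP_{A^k}` via `g` and `h`: there are members of the family, one of
the right arity for each relation symbol, such that `g` is a homomorphism from `Γ_P` to them and `h`
is one from them to `Γ_Q`. -/
def SandwichesLP (Γ : PromiseTemplate I D E) (A : Subring ℝ) {k : ℕ} (g : D → Fin k → ℤ)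
    (h : (Fin k → A) → E) : Prop :=
  ∃ R : ∀ i, Set (Fin (Γ.ar i) → Fin k → A), (∀ i, R i ∈ LPFamily A k (Γ.ar i)) ∧
    IsHom Γ.P R (intPoint A ∘ g) ∧ IsHom R Γ.Q h

/-- `v` is a solution over `A` of the Basic LP relaxation of `Ψ_P` with respect to `g`. -/
def BasicLP (Γ : PromiseTemplate I D E) (A : Subring ℝ) {k : ℕ} (g : D → Fin k → ℤ)
    (Ψ : Formula Γ.ar) (v : Fin Ψ.n → Fin k → A) : Prop :=
  (∀ i, v i ∈ convIn A (Set.range g)) ∧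
    ∀ c ∈ Ψ.constraints,
      v ∘ c.2 ∈ convRel A ((fun x p => g (x p.1) p.2) '' Γ.P c.1)

/-- The output is obtained from some solution over `A` of the Basic LP by applying `h` to the value
of every variable, or it is the rejection `[false]` and the Basic LP has no solution over `A`. -/
def RoundedBasicLP [Fintype E] (Γ : PromiseTemplate I D E) (A : Subring ℝ) {k : ℕ}
    (g : D → Fin k → ℤ) (h : (Fin k → A) → E) (Ψ : Formula Γ.ar) (out : List Bool) : Prop :=
  (∃ v, Γ.BasicLP A g Ψ v ∧ out = true :: Ψ.encAssignment (fun i => h (v i))) ∨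
    ((¬ ∃ v, Γ.BasicLP A g Ψ v) ∧ out = [false])

end PromiseTemplate

/-- Oracle access to `h : A^k → E`: the oracles that answer each query consisting of
representations of `a_1, …, a_k ∈ A` by `h (a_1, …, a_k)`. Nothing is assumed about the answers to
other queries. -/
def oraclesFor {A : Subring ℝ} (ρ : BitRep A) {E : Type*} [Fintype E] {k : ℕ}
    (h : (Fin k → A) → E) : Set Oracle :=
  {O | ∀ x : Fin k → ρ.Word, O (ρ.encTuple x) = encFin (h (fun c => ρ.val (x c)))}

end PromiseCSP

end

/-! Every relation in the Basic LP of `Ψ` is the real convex hull of finitely many integer points.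
Such a hull is cut out by finitely many linear inequalities with integer coefficients
(`exists_list_mem_convexHull_iff`, proved by Fourier–Motzkin elimination on the cone over the
points). These inequalities depend only on `Γ` and `g`. The Basic LP is therefore an integer system
whose rows are fixed inequalities applied to the variables of each constraint, and its solutions in
`A` are the solutions of the Basic LP over `A` (`exists_inequalities`).

The algorithm writes down this system, runs the LP solver of `A`, and asks the oracle for `h` at
each of the `n` points found. It does no arithmetic in `A`: the words printed by the solver are
passed verbatim to the oracle.

Correctness is convexity. A satisfying assignment of `Ψ_P`, mapped by `g`, solves the Basic LP.
Conversely, `R_i` is given by a convex hull that contains `g(P_i)`, hence it contains all of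
`Conv_A(g(P_i))`; so `h` sends a solution of the Basic LP to a satisfying assignment of `Ψ_Q`. Thus
rounding answers the search problem, and whether it rejects answers the decision problem.

The larger part of the proof realizes the algorithm on the stack machines. A small structured
language is compiled into machines, with a semantics `Runs` that composes and counts steps. The
program itself is `roundLP`, and `oraclePolyTime_roundedBasicLP` assembles its time bound. The fixed
inequalities are hard-wired into the control, so producing a row needs no arithmetic: every
coefficient of a variable is one of finitely many constants, determined by the set of positions at
which the variable occurs. -/

namespace PromiseCSP

/-! ### Single steps of a machine. -/

namespace Machine

variable {M : Machine} {O : Oracle} {c : M.Cfg}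

theorem step_push {k : M.K} {b : Bool} {q : M.Q} (h : M.instr c.state = .push k b q) :
    M.step O c = ⟨q, Function.update c.stk k (b :: c.stk k)⟩ := by
  simp only [step, h]

theorem step_pop {k : M.K} {f : Option Bool → M.Q} (h : M.instr c.state = .pop k f) :
    M.step O c = ⟨f (c.stk k).head?, Function.update c.stk k (c.stk k).tail⟩ := by
  simp only [step, h]

theorem step_query {q : M.Q} (h : M.instr c.state = .query q) :
    M.step O c = ⟨q, Function.update (Function.update c.stk M.qry []) M.ans (O (c.stk M.qry))⟩ := by
  simp only [step, h]

theorem step_of_halt (h : M.instr c.state = .halt) (t : ℕ) : (M.step O)^[t] c = c := by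
  induction t with
  | zero => rfl
  | succ t ih =>
    have : M.step O c = c := by simp only [step, h]
    rw [Function.iterate_succ_apply, this, ih]

end Machine

/-! ### Structured programs for multi-stack machines

Programs over work stacks `W` that may call a fixed machine `S` as a subroutine, running on stacks
of its own. -/

inductive Prog (S : Machine) (W : Type) : Type
  | skip
  | push (k : W ⊕ S.K) (b : Bool)
  | seq (p q : Prog S W)
  | case (k : W ⊕ S.K) (f : Option Bool → Prog S W)
  | loop (k : W ⊕ S.K) (c : Option Bool → Bool) (f : Option Bool → Prog S W)
  | query
  | run

namespace Prog

variable {S : Machine} {W : Type}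

/-- The control states of the compiled program. -/
def Lbl : Prog S W → Type
  | skip => Empty
  | push _ _ => Unit
  | seq p q => Lbl p ⊕ Lbl q
  | case _ f => Unit ⊕ (Σ o, Lbl (f o))
  | loop _ _ f => Unit ⊕ (Σ o, Lbl (f o))
  | query => Unit
  | run => S.Q

instance finite_lbl (p : Prog S W) : Finite p.Lbl := by
  induction p with
  | skip => exact inferInstanceAs (Finite Empty)
  | push k b => exact inferInstanceAs (Finite Unit)
  | seq p q hp hq => exact inferInstanceAs (Finite (Lbl p ⊕ Lbl q))
  | case k f ih => exact inferInstanceAs (Finite (Unit ⊕ (Σ o, Lbl (f o))))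
  | loop k c f ih => exact inferInstanceAs (Finite (Unit ⊕ (Σ o, Lbl (f o))))
  | query => exact inferInstanceAs (Finite Unit)
  | run => exact inferInstanceAs (Finite S.Q)

/-- The control state in which the subroutine continues: halting states are replaced by `next`. -/
def jump {Q : Type} (emb : S.Q → Q) (next : Q) (q : S.Q) : Q :=
  match S.instr q with
  | .halt => next
  | _ => emb q

/-- Compilation is in continuation style: `emb` places the control states of the program in an
ambient machine and `next` is where control goes afterwards. A program without states of its own,
such as `skip`, is entered at `next`. -/
def entry {Q : Type} : (p : Prog S W) → (Lbl p → Q) → Q → Q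
  | skip, _, next => next
  | push _ _, emb, _ => emb ()
  | seq p q, emb, next => entry p (fun l => emb (.inl l)) (entry q (fun l => emb (.inr l)) next)
  | case _ _, emb, _ => emb (.inl ())
  | loop _ _ _, emb, _ => emb (.inl ())
  | query, emb, _ => emb ()
  | run, emb, next => jump emb next S.start

/-- The instruction of the compiled program in a control state. -/
def code {Q : Type} : (p : Prog S W) → (Lbl p → Q) → Q → Lbl p → Instr (W ⊕ S.K) Q
  | push k b, _, next, _ => .push k b next
  | seq p q, emb, next, .inl l =>
      code p (fun l => emb (.inl l)) (entry q (fun l => emb (.inr l)) next) l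
  | seq _ q, emb, next, .inr l => code q (fun l => emb (.inr l)) next l
  | case k f, emb, next, .inl _ =>
      .pop k (fun o => entry (f o) (fun l => emb (.inr ⟨o, l⟩)) next)
  | case _ f, emb, next, .inr ⟨o, l⟩ => code (f o) (fun l => emb (.inr ⟨o, l⟩)) next l
  | loop k c f, emb, next, .inl _ =>
      .pop k (fun o => if c o then entry (f o) (fun l => emb (.inr ⟨o, l⟩)) (emb (.inl ())) else next)
  | loop _ _ f, emb, _, .inr ⟨o, l⟩ => code (f o) (fun l => emb (.inr ⟨o, l⟩)) (emb (.inl ())) l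
  | query, _, next, _ => .query next
  | run, emb, next, q =>
      match S.instr q with
      | .push k b q' => .push (.inr k) b (jump emb next q')
      | .pop k f => .pop (.inr k) (fun o => jump emb next (f o))
      | _ => .halt

variable [DecidableEq W] [Fintype W]

/-- A machine with the stacks of a program, whose input and output stacks are `io.1`, `io.2` and
whose oracle stacks are `qa.1`, `qa.2`. -/
def frame (S : Machine) {W : Type} [DecidableEq W] [Fintype W] (io qa : W × W) {Q : Type}
    [Fintype Q] (start : Q) (instr : Q → Instr (W ⊕ S.K) Q) : Machine where
  K := W ⊕ S.K
  Q := Q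
  decK := inferInstance
  finK := inferInstance
  finQ := inferInstance
  inp := .inl io.1
  out := .inl io.2
  qry := .inl qa.1
  ans := .inl qa.2
  start := start
  instr := instr

/-- The contents of the stacks of a program. -/
abbrev Store (S : Machine) (W : Type) : Type := W ⊕ S.K → List Bool

/-- Wherever the program is compiled into a machine, it leads from `s` to `s'` within `t` steps. -/
def Runs (O : Oracle) (qa : W × W) (p : Prog S W) (s s' : Store S W) (t : ℕ) : Prop :=
  ∀ (io : W × W) (Q : Type) (_ : Fintype Q) (start : Q) (instr : Q → Instr (W ⊕ S.K) Q)
    (emb : Lbl p → Q) (next : Q), (∀ l, instr (emb l) = code p emb next l) →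
    ∃ t' ≤ t, ((frame S io qa start instr).step O)^[t'] ⟨entry p emb next, s⟩ = ⟨next, s'⟩

variable {O : Oracle} {qa : W × W}

theorem Runs.mono {p : Prog S W} {s s' : Store S W} {t t' : ℕ} (h : Runs O qa p s s' t)
    (ht : t ≤ t') : Runs O qa p s s' t' := by
  intro io Q _ start instr emb next hl
  obtain ⟨u, hu, e⟩ := h io Q _ start instr emb next hl
  exact ⟨u, hu.trans ht, e⟩

theorem Runs.skip (s : Store S W) : Runs O qa .skip s s 0 :=
  fun _ _ _ _ _ _ _ _ => ⟨0, le_rfl, rfl⟩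

theorem Runs.push (k : W ⊕ S.K) (b : Bool) (s : Store S W) :
    Runs O qa (.push k b) s (Function.update s k (b :: s k)) 1 :=
  fun io _ _ start instr _ _ hl =>
    ⟨1, le_rfl, Machine.step_push (M := frame S io qa start instr) (c := ⟨_, s⟩) (hl ())⟩

theorem Runs.query (s : Store S W) :
    Runs O qa .query s (Function.update (Function.update s (.inl qa.1) []) (.inl qa.2)
      (O (s (.inl qa.1)))) 1 :=
  fun io _ _ start instr _ _ hl =>
    ⟨1, le_rfl, Machine.step_query (M := frame S io qa start instr) (c := ⟨_, s⟩) (hl ())⟩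

/-- Since `Runs` quantifies over all embeddings and continuations, the hypothesis on `p` applies
with the entry point of `q` as its continuation. -/
theorem Runs.seq {p q : Prog S W} {s s' s'' : Store S W} {t t' : ℕ} (h : Runs O qa p s s' t)
    (h' : Runs O qa q s' s'' t') : Runs O qa (.seq p q) s s'' (t + t') := by
  intro io Q _ start instr emb next hl
  obtain ⟨u, hu, e⟩ := h io Q _ start instr (fun l => emb (.inl l))
    (entry q (fun l => emb (.inr l)) next) (fun l => hl (.inl l))
  obtain ⟨u', hu', e'⟩ := h' io Q _ start instr (fun l => emb (.inr l)) next
    (fun l => hl (.inr l))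
  refine ⟨u' + u, by omega, ?_⟩
  rw [Function.iterate_add_apply]
  exact (congrArg _ e).trans e'

theorem Runs.case {k : W ⊕ S.K} {f : Option Bool → Prog S W} {s s' : Store S W} {t : ℕ}
    (h : Runs O qa (f (s k).head?) (Function.update s k (s k).tail) s' t) :
    Runs O qa (.case k f) s s' (t + 1) := by
  intro io Q _ start instr emb next hl
  obtain ⟨u, hu, e⟩ := h io Q _ start instr (fun l => emb (.inr ⟨_, l⟩)) next
    (fun l => hl (.inr ⟨_, l⟩))
  refine ⟨u + 1, by omega, ?_⟩
  rw [Function.iterate_add_apply, ← e]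
  exact congrArg _ (Machine.step_pop (M := frame S io qa start instr) (c := ⟨_, s⟩) (hl (.inl ())))

/-- The bit that ends a loop is popped as well. This is what consumes the final `false` of a unary
code. -/
theorem Runs.loop_exit {k : W ⊕ S.K} {c : Option Bool → Bool} {f : Option Bool → Prog S W}
    {s : Store S W} (h : c (s k).head? = false) :
    Runs O qa (.loop k c f) s (Function.update s k (s k).tail) 1 := by
  intro io Q _ start instr emb next hl
  refine ⟨1, le_rfl, (Machine.step_pop (M := frame S io qa start instr) (c := ⟨_, s⟩)
    (hl (.inl ()))).trans ?_⟩
  congr 1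
  exact if_neg (by rw [h]; simp)

/-- The body is compiled with the head of the loop as its continuation. -/
theorem Runs.loop_step {k : W ⊕ S.K} {c : Option Bool → Bool} {f : Option Bool → Prog S W}
    {s s' s'' : Store S W} {t t' : ℕ} (hc : c (s k).head? = true)
    (h : Runs O qa (f (s k).head?) (Function.update s k (s k).tail) s' t)
    (h' : Runs O qa (.loop k c f) s' s'' t') :
    Runs O qa (.loop k c f) s s'' (t + 1 + t') := by
  intro io Q _ start instr emb next hl
  obtain ⟨u, hu, e⟩ := h io Q _ start instr (fun l => emb (.inr ⟨_, l⟩)) (emb (.inl ()))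
    (fun l => hl (.inr ⟨_, l⟩))
  obtain ⟨u', hu', e'⟩ := h' io Q _ start instr emb next hl
  refine ⟨u' + (u + 1), by omega, ?_⟩
  rw [Function.iterate_add_apply]
  refine Eq.trans (congrArg _ ?_) e'
  rw [Function.iterate_add_apply]
  refine Eq.trans (congrArg _ ?_) e
  refine (Machine.step_pop (M := frame S io qa start instr) (c := ⟨_, s⟩) (hl (.inl ()))).trans ?_
  congr 1
  exact if_pos hc

/-- A loop that makes `n` iterations through the states `σ 0, …, σ n`. -/
theorem Runs.loop_iterate {k : W ⊕ S.K} {c : Option Bool → Bool} {f : Option Bool → Prog S W}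
    (σ : ℕ → Store S W) (n t : ℕ) (hc : ∀ j < n, c (σ j k).head? = true)
    (h : ∀ j < n, Runs O qa (f (σ j k).head?) (Function.update (σ j) k (σ j k).tail) (σ (j + 1)) t)
    (hn : c (σ n k).head? = false) :
    Runs O qa (.loop k c f) (σ 0) (Function.update (σ n) k (σ n k).tail) (n * (t + 1) + 1) := by
  induction n generalizing σ with
  | zero => simpa using Runs.loop_exit hn
  | succ n ih =>
    have := ih (fun j => σ (j + 1)) (fun j hj => hc _ (by omega)) (fun j hj => h _ (by omega)) hn
    refine (Runs.loop_step (hc 0 (by omega)) (h 0 (by omega)) this).mono (le_of_eq (by ring))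

/-- The subroutine, started from its initial configuration, produces its output. -/
theorem Runs.run (hS : S.OracleFree) {x y : List Bool} {t : ℕ} {s : Store S W}
    (hs : ∀ k, s (.inr k) = Function.update (fun _ => []) S.inp x k)
    (h : S.Outputs (fun _ => []) x y t) :
    ∃ σ : S.K → List Bool, σ S.out = y ∧
      Runs O qa .run s (Sum.elim (fun w => s (.inl w)) σ) t := by
  refine ⟨_, h.2, ?_⟩
  intro io Q _ start instr emb next hl
  -- The simulation is step by step, from an arbitrary configuration of the subroutine. Entering a
  -- halting state already means being at `next`, so idle steps after halting cost nothing; hence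
  -- `t' ≤ t`.
  have key : ∀ (t : ℕ) (c : S.Cfg) (s : Store S W), (∀ k, s (.inr k) = c.stk k) →
      S.instr ((S.step fun _ => [])^[t] c).state = .halt → ∃ t' ≤ t,
      ((frame S io qa start instr).step O)^[t'] ⟨jump emb next c.state, s⟩ =
        ⟨next, Sum.elim (fun w => s (.inl w)) ((S.step fun _ => [])^[t] c).stk⟩ := by
    intro t
    induction t with
    | zero =>
      intro c s hs hc
      refine ⟨0, le_rfl, ?_⟩
      have hc' : S.instr c.state = .halt := hc
      simp only [Function.iterate_zero, id, jump, hc']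
      congr 1
      funext k
      cases k <;> simp [hs]
    | succ t ih =>
      intro c s hs hc
      rw [Function.iterate_succ_apply] at hc ⊢
      cases e : S.instr c.state with
      | halt =>
        have h1 : S.step (fun _ => []) c = c := by simp only [Machine.step, e]
        rw [h1] at hc ⊢
        obtain ⟨u, hu, h2⟩ := ih c s hs hc
        exact ⟨u, by omega, h2⟩
      | query q' => exact absurd e (hS _ _)
      | push k b q' =>
        rw [Machine.step_push e] at hc ⊢
        obtain ⟨u, hu, h2⟩ := ih _ (Function.update s (.inr k) (b :: s (.inr k))) (by
          intro k'
          by_cases hk : k' = k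
          · subst hk; simp [hs]
          · simp [hk, hs]) hc
        refine ⟨u + 1, by omega, ?_⟩
        rw [Function.iterate_succ_apply]
        refine Eq.trans (congrArg _ ?_) h2
        refine Machine.step_push (M := frame S io qa start instr) (c := ⟨_, s⟩) ?_
        simp only [frame, jump, e]
        refine (hl _).trans ?_
        simp only [code, e]
        rfl
      | pop k f =>
        rw [Machine.step_pop e, ← hs k] at hc ⊢
        obtain ⟨u, hu, h2⟩ := ih _ (Function.update s (.inr k) (s (.inr k)).tail) (by
          intro k'
          by_cases hk : k' = k
          · subst hk; simp [hs]
          · simp [hk, hs]) hc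
        refine ⟨u + 1, by omega, ?_⟩
        rw [Function.iterate_succ_apply]
        refine Eq.trans (congrArg _ ?_) h2
        refine Machine.step_pop (M := frame S io qa start instr) (c := ⟨_, s⟩)
          (f := fun o => jump emb next (f o)) ?_
        simp only [frame, jump, e]
        refine (hl _).trans ?_
        simp only [code, e]
        rfl
  exact key t (S.initial x) s hs h.1

/-- The machine that executes a program and halts. -/
noncomputable def toMachine (p : Prog S W) (io qa : W × W) : Machine :=
  letI : Fintype p.Lbl := Fintype.ofFinite _
  frame S io qa (Q := Option p.Lbl) (entry p some none) (fun q =>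
    match q with
    | none => .halt
    | some l => code p some none l)

/-- The additional state `none` is the continuation of the whole program and halts, so the final
store persists up to time `t`. -/
theorem Runs.outputs {p : Prog S W} {io : W × W} {x : List Bool} {s : Store S W} {t : ℕ}
    (h : Runs O qa p (Function.update (fun _ => []) (.inl io.1) x) s t) :
    (p.toMachine io qa).Outputs O x (s (.inl io.2)) t := by
  let _ : Fintype p.Lbl := Fintype.ofFinite _
  obtain ⟨u, hu, e⟩ := h io (Option p.Lbl) _ (entry p some none) (fun q =>
    match q with
    | none => .halt
    | some l => code p some none l) some none (fun l => rfl)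
  have e' : ((p.toMachine io qa).step O)^[u] ((p.toMachine io qa).initial x) = ⟨none, s⟩ := e
  have h2 : ((p.toMachine io qa).step O)^[t] ((p.toMachine io qa).initial x) = ⟨none, s⟩ := by
    obtain ⟨d, rfl⟩ := Nat.exists_eq_add_of_le' hu
    rw [Function.iterate_add_apply, e']
    exact Machine.step_of_halt rfl d
  constructor
  · rw [h2]; rfl
  · rw [h2]; rfl

end Prog

/-- Within `t` steps, a machine that gets no answers from its oracle lengthens every stack by at
most `t`. -/
theorem Machine.length_stk_le {M : Machine} (k : M.K) (t : ℕ) (c : M.Cfg) :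
    (((M.step fun _ => [])^[t] c).stk k).length ≤ (c.stk k).length + t := by
  induction t with
  | zero => simp
  | succ t ih =>
    rw [Function.iterate_succ_apply']
    generalize (M.step fun _ => [])^[t] c = d at ih
    have : ((M.step (fun _ => []) d).stk k).length ≤ (d.stk k).length + 1 := by
      simp only [Machine.step]
      cases e : M.instr d.state with
      | halt => simp
      | query q' =>
        simp only [Function.update_apply]
        split_ifs <;> simp
      | push k' b q =>
        by_cases hk : k = k'
        · subst hk; simp
        · simp [hk]
      | pop k' f =>
        by_cases hk : k = k'
        · subst hk; simp; omega
        · simp [hk]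
    omega

theorem Machine.Outputs.length_le {M : Machine} {x y : List Bool} {t : ℕ}
    (h : M.Outputs (fun _ => []) x y t) : y.length ≤ x.length + t := by
  have h1 := M.length_stk_le M.out t (M.initial x)
  rw [h.2] at h1
  refine h1.trans (Nat.add_le_add_right ?_ t)
  simp only [Machine.initial]
  by_cases hk : M.out = M.inp
  · rw [hk]; simp
  · simp [hk]

/-! ### Integer inequalities for the convex hull of finitely many integer points -/

/-- Elimination of one nonnegative variable from a finite system of linear inequalities. -/
theorem exists_nonneg_forall_le_mul_iff {κ : Type*} {L : Set κ} (hL : L.Finite) (α β : κ → ℝ) :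
    (∃ a, 0 ≤ a ∧ ∀ r ∈ L, α r ≤ a * β r) ↔
      (∀ r ∈ L, β r ≤ 0 → α r ≤ 0) ∧
        ∀ r ∈ L, ∀ r' ∈ L, 0 < β r → β r' < 0 → -β r' * α r + β r * α r' ≤ 0 := by
  constructor
  · rintro ⟨a, ha, h⟩
    refine ⟨fun r hr hb => (h r hr).trans (mul_nonpos_of_nonneg_of_nonpos ha hb), ?_⟩
    intro r hr r' hr' hb hb'
    have h1 := mul_le_mul_of_nonneg_left (h r hr) (neg_nonneg.2 hb'.le)
    have h2 := mul_le_mul_of_nonneg_left (h r' hr') hb.le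
    linarith
  · rintro ⟨h1, h2⟩
    -- The least admissible value: the maximum of `0` and all lower bounds `α r / β r` with `β r >
    -- 0`.
    obtain ⟨a, ha, hmax⟩ := Set.exists_max_image
      (insert 0 ((fun r => α r / β r) '' {r ∈ L | 0 < β r})) id
      (((hL.subset (Set.sep_subset _ _)).image _).insert 0) ⟨0, Set.mem_insert _ _⟩
    refine ⟨a, hmax 0 (Set.mem_insert _ _), fun r hr => ?_⟩
    rcases lt_trichotomy (β r) 0 with hb | hb | hb
    · rcases ha with rfl | ⟨r₀, ⟨hr₀, hb₀⟩, rfl⟩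
      · simpa using h1 r hr hb.le
      · have := h2 r₀ hr₀ r hr hb₀ hb
        have h3 : α r₀ / β r₀ * β r = α r₀ * β r / β r₀ := by ring
        simp only
        rw [h3, le_div_iff₀ hb₀]
        linarith
    · simpa [hb] using h1 r hr hb.le
    · exact (div_le_iff₀ hb).1 (hmax _ (Or.inr ⟨r, ⟨hr, hb⟩, rfl⟩))

open scoped NNReal

/-- The convex hull is the section of the cone over the points at height one. -/
theorem mem_convexHull_iff_mem_span {ι : Type*} (S : Finset (ι → ℝ)) (x : ι → ℝ) :
    x ∈ convexHull ℝ (S : Set (ι → ℝ)) ↔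
      (fun o : Option ι => o.elim 1 x) ∈
        Submodule.span ℝ≥0 ((fun (y : ι → ℝ) (o : Option ι) => o.elim 1 y) '' (S : Set (ι → ℝ))) := by
  classical
  have hinj : Function.Injective (fun (y : ι → ℝ) (o : Option ι) => o.elim 1 y) := by
    intro y z e
    funext i
    exact congrFun e (some i)
  rw [Finset.mem_convexHull', ← Finset.coe_image, Submodule.mem_span_finset]
  constructor
  · rintro ⟨w, hw, h1, hx⟩
    -- The membership test makes the coefficients vanish outside the lifted points, as required of
    -- the support in `Submodule.mem_span_finset`.
    refine ⟨fun z => if z ∈ S.image (fun (y : ι → ℝ) (o : Option ι) => o.elim 1 y) then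
      (w fun i => z (some i)).toNNReal else 0, ?_, ?_⟩
    · intro z hz
      by_contra hn
      exact hz (if_neg hn)
    · rw [Finset.sum_image fun _ _ _ _ e => hinj e]
      funext o
      rw [Finset.sum_apply]
      have hterm : ∀ y ∈ S, ((if (fun o : Option ι => o.elim 1 y) ∈
          S.image (fun (y : ι → ℝ) (o : Option ι) => o.elim 1 y) then
          (w fun i => (fun o : Option ι => (o.elim 1 y : ℝ)) (some i)).toNNReal else 0) •
          (fun o : Option ι => (o.elim 1 y : ℝ))) o = w y * o.elim 1 y := by
        intro y hy
        rw [if_pos (Finset.mem_image_of_mem _ hy)]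
        simp [NNReal.smul_def, hw y hy]
      rw [Finset.sum_congr rfl hterm]
      cases o with
      | none => simpa using h1
      | some i =>
        have := congrFun hx i
        simpa using this
  · rintro ⟨f, -, hx⟩
    rw [Finset.sum_image fun _ _ _ _ e => hinj e] at hx
    refine ⟨fun y => f (fun o => o.elim 1 y), fun y _ => NNReal.coe_nonneg _, ?_, ?_⟩
    · have := congrFun hx none
      simpa [NNReal.smul_def] using this
    · funext i
      have := congrFun hx (some i)
      simpa [NNReal.smul_def] using this

variable {ι : Type*} [Fintype ι]

/-- A finitely generated integer cone is defined by finitely many integer inequalities. -/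
theorem exists_finite_mem_span_iff {S : Set (ι → ℤ)} (hS : S.Finite) :
    ∃ L : Set (ι → ℤ), L.Finite ∧ ∀ x : ι → ℝ,
      x ∈ Submodule.span ℝ≥0 ((fun (z : ι → ℤ) i => (z i : ℝ)) '' S) ↔
        ∀ r ∈ L, ∑ i, (r i : ℝ) * x i ≤ 0 := by
  classical
  induction S, hS using Set.Finite.induction_on with
  | empty =>
    -- The zero cone is defined by `x i ≤ 0` and `-x i ≤ 0` for all `i`.
    refine ⟨Set.range (fun i : ι => Pi.single i 1) ∪ Set.range (fun i : ι => Pi.single i (-1)),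
      (Set.finite_range _).union (Set.finite_range _), fun x => ?_⟩
    simp only [Set.image_empty, Submodule.span_empty, Submodule.mem_bot, Set.mem_union,
      Set.mem_range, or_imp, forall_and, forall_exists_index, forall_apply_eq_imp_iff]
    simp only [Pi.single_apply, Int.cast_ite, Int.cast_one, Int.cast_zero, Int.cast_neg, ite_mul,
      one_mul, zero_mul, neg_mul, Finset.sum_ite_eq', Finset.mem_univ, if_true]
    constructor
    · rintro rfl
      simp
    · rintro ⟨h1, h2⟩
      funext i
      exact le_antisymm (h1 i) (neg_nonpos.1 (h2 i))
  | @insert s S _ _ ih =>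
    obtain ⟨L, hL, h⟩ := ih
    let d : (ι → ℤ) → ℤ := fun r => ∑ i, r i * s i
    -- A point lies in the larger cone iff subtracting `a • s`, for some `a ≥ 0`, leaves a point of
    -- the smaller one. Eliminating `a` keeps the rows with `d r ≤ 0` and adds the positive
    -- combinations in which `a` cancels.
    refine ⟨{r ∈ L | d r ≤ 0} ∪ Set.image2 (fun r r' i => -d r' * r i + d r * r' i)
      {r ∈ L | 0 < d r} {r ∈ L | d r < 0}, (hL.subset (Set.sep_subset _ _)).union
      ((hL.subset (Set.sep_subset _ _)).image2 _ (hL.subset (Set.sep_subset _ _))), fun x => ?_⟩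
    have key := exists_nonneg_forall_le_mul_iff hL (fun r => ∑ i, (r i : ℝ) * x i)
      (fun r => (d r : ℝ))
    rw [Set.image_insert_eq, Submodule.mem_span_insert]
    trans ∃ a, 0 ≤ a ∧ ∀ r ∈ L, ∑ i, (r i : ℝ) * x i ≤ a * (d r : ℝ)
    · have hsub : ∀ (a : ℝ) (r : ι → ℤ), ∑ i, (r i : ℝ) * (x i - a * s i) =
          ∑ i, (r i : ℝ) * x i - a * (d r : ℝ) := by
        intro a r
        simp only [d, Int.cast_sum, Int.cast_mul, Finset.mul_sum, ← Finset.sum_sub_distrib]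
        exact Finset.sum_congr rfl fun i _ => by ring
      constructor
      · rintro ⟨a, z, hz, hx⟩
        refine ⟨a, a.2, fun r hr => ?_⟩
        have := (h z).1 hz r hr
        have hz' : z = fun i => x i - a * s i := by
          funext i
          rw [hx]
          simp [NNReal.smul_def]
        rw [hz', hsub] at this
        linarith
      · rintro ⟨a, ha, hr⟩
        refine ⟨⟨a, ha⟩, fun i => x i - a * s i, (h _).2 fun r hr' => ?_, ?_⟩
        · rw [hsub]
          linarith [hr r hr']
        · funext i
          change x i = a * (s i : ℝ) + (x i - a * s i)
          ring
    · rw [key]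
      simp only [Set.mem_union, or_imp, forall_and, Set.mem_image2, Set.mem_ofPred_eq]
      refine and_congr ?_ ?_
      · simp only [and_imp, Int.cast_nonpos]
      · have hcomb : ∀ r r' : ι → ℤ, ∑ i, ((-d r' * r i + d r * r' i : ℤ) : ℝ) * x i =
            -(d r' : ℝ) * ∑ i, (r i : ℝ) * x i + (d r : ℝ) * ∑ i, (r' i : ℝ) * x i := by
          intro r r'
          simp only [Finset.mul_sum, ← Finset.sum_add_distrib]
          refine Finset.sum_congr rfl fun i _ => ?_
          push_cast
          ring
        constructor
        · rintro h1 _ ⟨r, ⟨hr, hb⟩, r', ⟨hr', hb'⟩, rfl⟩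
          rw [hcomb]
          exact h1 r hr r' hr' (by exact_mod_cast hb) (by exact_mod_cast hb')
        · intro h1 r hr r' hr' hb hb'
          rw [← hcomb]
          exact h1 _ ⟨r, ⟨hr, by exact_mod_cast hb⟩, r', ⟨hr', by exact_mod_cast hb'⟩, rfl⟩

/-- The convex hull of finitely many integer points is defined by finitely many linear inequalities
with integer coefficients. -/
theorem exists_list_mem_convexHull_iff {S : Set (ι → ℤ)} (hS : S.Finite) :
    ∃ L : List ((ι → ℤ) × ℤ), ∀ x : ι → ℝ,
      x ∈ convexHull ℝ ((fun (z : ι → ℤ) i => (z i : ℝ)) '' S) ↔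
        ∀ r ∈ L, ∑ i, (r.1 i : ℝ) * x i ≤ r.2 := by
  classical
  obtain ⟨L, hL, h⟩ := exists_finite_mem_span_iff
    (hS.image fun (z : ι → ℤ) (o : Option ι) => o.elim 1 z)
  -- At height one the coefficient of `none` is a constant term, which moves to the right-hand side.
  refine ⟨hL.toFinset.toList.map fun r => (fun i => r (some i), -r none), fun x => ?_⟩
  have hF := mem_convexHull_iff_mem_span
    ((hS.image fun (z : ι → ℤ) i => (z i : ℝ)).toFinset) x
  rw [Set.Finite.coe_toFinset] at hF
  rw [hF, Set.image_image]
  have himg : (fun (z : ι → ℤ) (o : Option ι) => (o.elim 1 fun i => (z i : ℝ) : ℝ)) '' S =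
      (fun (z : Option ι → ℤ) o => (z o : ℝ)) '' ((fun (z : ι → ℤ) o => o.elim 1 z) '' S) := by
    rw [Set.image_image]
    refine Set.image_congr fun z _ => ?_
    funext o
    cases o <;> simp
  rw [himg, h]
  simp only [List.mem_map, Finset.mem_toList, Set.Finite.mem_toFinset, forall_exists_index, and_imp,
    forall_apply_eq_imp_iff₂, Fintype.sum_option, Option.elim, Int.cast_neg]
  refine forall₂_congr fun r _ => ?_
  constructor <;> intro h <;> linarith

/-! ### The Basic LP as an integer system -/

/-- A linear inequality with integer coefficients. -/
abbrev Ineq (ι : Type*) : Type _ := (ι → ℤ) × ℤ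

/-- The coefficient of the coordinate `c` of the variable `j`, if an inequality for the `l`-tuples of
points is applied to the variables `x`. -/
def varCoeff {k l : ℕ} (r : Fin l × Fin k → ℤ) (x : Fin l → ℕ) (j : ℕ) (c : Fin k) : ℤ :=
  ∑ p, if x p = j then r (p, c) else 0

/-- The inequalities for the `l`-tuples of points, applied to the variables `x`. -/
def rowsAt (n : ℕ) {k l : ℕ} (L : List (Ineq (Fin l × Fin k))) (x : Fin l → ℕ) :
    List (Ineq (Fin (n * k))) :=
  L.map fun r => (fun q => varCoeff r.1 x q.divNat q.modNat, r.2)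

/-- The integer system with given rows. -/
def IntSystem.ofRows {n : ℕ} (R : List (Ineq (Fin n))) : IntSystem where
  m := R.length
  n := n
  M i j := R[i].1 j
  b i := R[i].2

/-- Code of a row of an integer system. -/
def encRow {n : ℕ} (r : Ineq (Fin n)) : List Bool :=
  (List.ofFn fun j => encInt (r.1 j)).flatten ++ encInt r.2

theorem IntSystem.encode_ofRows {n : ℕ} (R : List (Ineq (Fin n))) :
    (ofRows R).encode = encNat R.length ++ encNat n ++ R.flatMap encRow := by
  simp only [encode, ofRows, List.flatMap]
  congr 2
  change List.ofFn (fun i : Fin R.length => encRow R[i]) = _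
  apply List.ext_getElem <;> simp

theorem IntSystem.isSolution_ofRows {n : ℕ} (R : List (Ineq (Fin n))) {A : Subring ℝ}
    (x : Fin n → A) : (ofRows R).IsSolution x ↔ ∀ r ∈ R, ∑ j, (r.1 j : ℝ) * (x j : ℝ) ≤ r.2 := by
  simp only [IsSolution, ofRows]
  constructor
  · intro h r hr
    obtain ⟨i, hi, rfl⟩ := List.getElem_of_mem hr
    exact h ⟨i, hi⟩
  · intro h i
    exact h _ (List.getElem_mem i.2)

/-- The coordinates of `n` points, from a single tuple. -/
def points {A : Type*} {n k : ℕ} (x : Fin (n * k) → A) (i : Fin n) (c : Fin k) : A :=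
  x (finProdFinEquiv (i, c))

/-- A variable may occur at several positions of a constraint; its coefficients are then added up.
-/
theorem sum_varCoeff {k l n : ℕ} (r : Fin l × Fin k → ℤ) (v : Fin l → Fin n)
    (x : Fin (n * k) → ℝ) :
    ∑ q : Fin (n * k), (varCoeff r (fun p => v p) q.divNat q.modNat : ℝ) * x q =
      ∑ p, (r p : ℝ) * points x (v p.1) p.2 := by
  rw [← finProdFinEquiv.sum_comp, Fintype.sum_prod_type, Fintype.sum_prod_type]
  have h : ∀ (j : Fin n) (c : Fin k), (varCoeff r (fun p => v p)
      (finProdFinEquiv (j, c)).divNat (finProdFinEquiv (j, c)).modNat : ℝ) *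
        x (finProdFinEquiv (j, c)) =
      ∑ p, if v p = j then (r (p, c) : ℝ) * points x (v p) c else 0 := by
    intro j c
    have e := finProdFinEquiv.symm_apply_apply (j, c)
    have e1 : (finProdFinEquiv (j, c)).divNat = j := congrArg Prod.fst e
    have e2 : (finProdFinEquiv (j, c)).modNat = c := congrArg Prod.snd e
    rw [e1, e2, varCoeff]
    push_cast
    rw [Finset.sum_mul]
    refine Finset.sum_congr rfl fun p _ => ?_
    by_cases hp : v p = j
    · simp [hp, points]
    · simp [hp, Fin.val_inj]
  simp only [h]
  rw [Finset.sum_comm, Finset.sum_comm (f := fun p c => (r (p, c) : ℝ) * points x (v p) c)]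
  refine Finset.sum_congr rfl fun c _ => ?_
  rw [Finset.sum_comm]
  simp

namespace PromiseTemplate

variable {I D E : Type*} (Γ : PromiseTemplate I D E) {k : ℕ}

/-- The rows of the integer system that expresses the Basic LP of a formula, given inequalities for
the convex hulls of the domain and of the relations. -/
def rows (LD : List (Ineq (Fin 1 × Fin k))) (L : ∀ i, List (Ineq (Fin (Γ.ar i) × Fin k)))
    (Ψ : Formula Γ.ar) : List (Ineq (Fin (Ψ.n * k))) :=
  (List.range Ψ.n).flatMap (fun i => rowsAt Ψ.n LD fun _ => i) ++
    Ψ.constraints.flatMap fun c => rowsAt Ψ.n (L c.1) fun p => c.2 p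

/-- The order of the quantifiers matters: the inequalities are chosen before `A` and `Ψ`, so a
single machine can contain them. -/
theorem exists_inequalities [Finite D] (g : D → Fin k → ℤ) :
    ∃ (LD : List (Ineq (Fin 1 × Fin k))) (L : ∀ i, List (Ineq (Fin (Γ.ar i) × Fin k))),
      ∀ (A : Subring ℝ) (Ψ : Formula Γ.ar) (x : Fin (Ψ.n * k) → A),
        (IntSystem.ofRows (Γ.rows LD L Ψ)).IsSolution x ↔ Γ.BasicLP A g Ψ (points x) := by
  obtain ⟨LD, hD⟩ := exists_list_mem_convexHull_iff (Set.finite_range g)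
  have hfin : ∀ i, ((fun (x : Fin (Γ.ar i) → D) (p : Fin (Γ.ar i) × Fin k) => g (x p.1) p.2) ''
      Γ.P i).Finite := fun i => (Set.toFinite (Γ.P i)).image _
  choose L hL using fun i => exists_list_mem_convexHull_iff (hfin i)
  -- An inequality for a single point is read as one for `1`-tuples, so that variables and
  -- constraints are treated alike.
  refine ⟨LD.map fun r => (fun p => r.1 p.2, r.2), L, fun A Ψ x => ?_⟩
  rw [IntSystem.isSolution_ofRows]
  have key : ∀ {l : ℕ} (M : List (Ineq (Fin l × Fin k))) (v : Fin l → Fin Ψ.n),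
      (∀ r ∈ rowsAt Ψ.n M fun p => v p, ∑ j, (r.1 j : ℝ) * (x j : ℝ) ≤ r.2) ↔
        ∀ r ∈ M, ∑ p, (r.1 p : ℝ) * ((points x (v p.1) p.2 : A) : ℝ) ≤ r.2 := by
    intro l M v
    simp only [rowsAt, List.mem_map, forall_exists_index, and_imp, forall_apply_eq_imp_iff₂]
    refine forall₂_congr fun r _ => ?_
    rw [sum_varCoeff r.1 v (fun j => (x j : ℝ))]
    rfl
  simp only [rows, List.mem_append, or_imp, forall_and, List.mem_flatMap, forall_exists_index,
    and_imp]
  refine and_congr ?_ ?_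
  · constructor
    · intro h i
      refine (hD _).2 fun r hr => ?_
      have := (key (l := 1) _ (fun _ => i)).1 (fun r hr => h r i (List.mem_range.2 i.2) hr) _
        (List.mem_map_of_mem hr)
      simpa [Fintype.sum_prod_type] using this
    · intro h r i hi hr
      refine (key (l := 1) _ (fun _ => ⟨i, List.mem_range.1 hi⟩)).2 ?_ r hr
      simp only [List.mem_map, forall_exists_index, and_imp, forall_apply_eq_imp_iff₂]
      intro r hr
      have := (hD _).1 (h ⟨i, List.mem_range.1 hi⟩) r hr
      simpa [Fintype.sum_prod_type] using this
  · constructor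
    · intro h c hc
      exact (hL c.1 _).2 ((key _ c.2).1 fun r hr => h r c hc hr)
    · intro h r c hc hr
      exact (key _ c.2).2 ((hL c.1 _).1 (h c hc)) r hr

/-! ### Correctness of rounding. -/

variable {Γ}

/-- Rounding a solution of the Basic LP gives a satisfying assignment of `Ψ_Q`. -/
theorem SandwichesLP.satisfies {A : Subring ℝ} {g : D → Fin k → ℤ} {h : (Fin k → A) → E}
    (hgh : Γ.SandwichesLP A g h) {Ψ : Formula Γ.ar} {v : Fin Ψ.n → Fin k → A}
    (hv : Γ.BasicLP A g Ψ v) : Ψ.Satisfies Γ.Q fun i => h (v i) := by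
  obtain ⟨R, hR, hP, hQ⟩ := hgh
  intro c hc
  refine hQ c.1 (v ∘ c.2) ?_
  obtain ⟨-, S, -, hS⟩ := hR c.1
  have h1 := hv.2 c hc
  rw [hS]
  -- It suffices that the generating points, the images under `g` of tuples in `P`, lie in the
  -- convex hull that defines `R`.
  refine convexHull_min ?_ (convex_convexHull ℝ _) h1
  rintro _ ⟨_, ⟨x, hx, rfl⟩, rfl⟩
  have h2 := hP c.1 x hx
  rw [hS] at h2
  have e : (fun p => ((Function.uncurry ((intPoint A ∘ g) ∘ x) p : A) : ℝ)) =
      fun p : Fin (Γ.ar c.1) × Fin k => (g (x p.1) p.2 : ℝ) := by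
    funext p
    simp [Function.uncurry, intPoint]
  have h3 : (fun p => ((Function.uncurry ((intPoint A ∘ g) ∘ x) p : A) : ℝ)) ∈
    convexHull ℝ ((fun (z : Fin (Γ.ar c.1) × Fin k → ℤ) p => (z p : ℝ)) '' S) := h2
  rw [e] at h3
  exact h3

/-- The points `g (x i)` and their tuples are themselves generators of the hulls. -/
theorem basicLP_of_satisfies {A : Subring ℝ} {g : D → Fin k → ℤ} {Ψ : Formula Γ.ar}
    {x : Fin Ψ.n → D} (hx : Ψ.Satisfies Γ.P x) :
    Γ.BasicLP A g Ψ fun i => intPoint A (g (x i)) := by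
  constructor
  · intro i
    refine subset_convexHull ℝ _ ⟨g (x i), ⟨x i, rfl⟩, ?_⟩
    funext c
    simp [intPoint]
  · intro c hc
    refine subset_convexHull ℝ _ ⟨_, ⟨_, hx c hc, rfl⟩, ?_⟩
    funext p
    simp [intPoint, Function.uncurry]

/-- Rounding a solution of the Basic LP solves the search problem. -/
theorem RoundedBasicLP.searchPCSP [Fintype I] [Fintype E] {A : Subring ℝ} {g : D → Fin k → ℤ}
    {h : (Fin k → A) → E} (hgh : Γ.SandwichesLP A g h) {Ψ : Formula Γ.ar} {out : List Bool}
    (ho : Γ.RoundedBasicLP A g h Ψ out) : Γ.SearchPCSP Ψ out := by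
  rintro ⟨x, hx⟩
  rcases ho with ⟨v, hv, rfl⟩ | ⟨hn, -⟩
  · exact ⟨_, hgh.satisfies hv, rfl⟩
  · exact absurd ⟨_, basicLP_of_satisfies hx⟩ hn

/-- An algorithm that rounds solutions of the Basic LP decides the promise problem. -/
theorem pcsp_mem_oracleP [Fintype I] [Fintype E] {A : Subring ℝ} {g : D → Fin k → ℤ}
    {h : (Fin k → A) → E} (hgh : Γ.SandwichesLP A g h) {𝒪 : Set Oracle}
    (ho : OraclePolyTime 𝒪 Formula.encode (Γ.RoundedBasicLP A g h)) : Γ.PCSP ∈ OracleP 𝒪 := by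
  obtain ⟨M, p, hM⟩ := ho
  refine ⟨M, p, fun O hO w hw => ?_⟩
  obtain ⟨Ψ, rfl⟩ : ∃ Ψ : Formula Γ.ar, Ψ.encode = w := by
    rcases hw with ⟨Ψ, -, e⟩ | ⟨Ψ, -, e⟩ <;> exact ⟨Ψ, e⟩
  obtain ⟨y, hy, -⟩ := hM O hO Ψ
  -- Injectivity of the encoding is not needed: formulas with the same code lead to the same run, so
  -- one output is correct for all of them.
  have hr : ∀ Ψ' : Formula Γ.ar, Ψ'.encode = Ψ.encode → Γ.RoundedBasicLP A g h Ψ' y := by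
    intro Ψ' e
    obtain ⟨y', hy', hr⟩ := hM O hO Ψ'
    rw [e] at hy'
    rwa [← hy.2, hy'.2]
  refine ⟨y, hy, ?_, ?_⟩
  · rintro ⟨Ψ', ⟨x, hx⟩, e⟩
    rcases hr Ψ' e with ⟨v, -, rfl⟩ | ⟨hn, -⟩
    · rfl
    · exact absurd ⟨_, basicLP_of_satisfies hx⟩ hn
  · rintro ⟨Ψ', hn, e⟩
    rcases hr Ψ' e with ⟨v, hv, -⟩ | ⟨-, rfl⟩
    · exact absurd ⟨_, hgh.satisfies hv⟩ hn
    · rfl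

end PromiseTemplate

namespace Prog

/-! ### Program idioms -/

section Idioms

variable {S : Machine} {W : Type} [DecidableEq W] [Fintype W] {O : Oracle} {qa : W × W}

/-- Push a word, from its first to its last bit. -/
def pushWord (y : W ⊕ S.K) (w : List Bool) : Prog S W :=
  w.foldr (fun b p => .seq (.push y b) p) .skip

theorem Runs.pushWord (y : W ⊕ S.K) (w : List Bool) (s : Store S W) :
    Runs O qa (.pushWord y w) s (Function.update s y (w.reverse ++ s y)) w.length := by
  induction w generalizing s with
  | nil => simpa [Prog.pushWord] using Runs.skip s
  | cons b w ih =>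
    have := (Runs.push (O := O) (qa := qa) y b s).seq (ih _)
    simp only [Function.update_idem, Function.update_self] at this
    refine Runs.mono (s' := _) ?_ (le_of_eq (Nat.add_comm _ _))
    simpa [Prog.pushWord] using this

/-- Move a stack on top of another one, in reverse order. -/
def move (x y : W ⊕ S.K) : Prog S W :=
  .loop x Option.isSome fun o => .push y (o.getD false)

theorem Runs.move {x y : W ⊕ S.K} (hxy : x ≠ y) (s : Store S W) :
    Runs O qa (.move x y) s (Function.update (Function.update s x []) y ((s x).reverse ++ s y))
      (2 * (s x).length + 1) := by
  generalize e : s x = l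
  induction l generalizing s with
  | nil =>
    have := Runs.loop_exit (O := O) (qa := qa) (k := x) (c := Option.isSome)
      (f := fun o => .push y (o.getD false)) (s := s) (by simp [e])
    have h2 : Function.update (Function.update s x []) y (s y) = Function.update s x [] := by
      simp [Function.update_of_ne hxy.symm]
    simpa [e, h2, Prog.move] using this
  | cons b l ih =>
    have h1 := Runs.push (O := O) (qa := qa) y b (Function.update s x l)
    have h2 := ih (Function.update (Function.update s x l) y
      (b :: Function.update s x l y)) (by simp [Function.update_of_ne hxy])
    have h3 : Function.update (Function.update (Function.update (Function.update s x l) y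
        (b :: s y)) x []) y (l.reverse ++ b :: s y) =
      Function.update (Function.update s x []) y (l.reverse ++ b :: s y) := by
      funext z
      by_cases hz : z = y
      · simp [hz]
      · by_cases hz' : z = x
        · simp [hz', hxy]
        · simp [hz, hz']
    simp only [Function.update_self, Function.update_of_ne hxy.symm] at h1 h2
    rw [h3] at h2
    have := Runs.loop_step (c := Option.isSome) (k := x) (f := fun o => .push y (o.getD false))
      (s := s) (by simp [e]) (by simpa [e] using h1) h2
    refine Runs.mono (s' := _) ?_ (show 1 + 1 + (2 * l.length + 1) ≤ _ by
      simp only [List.length_cons]; omega)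
    simpa [Prog.move] using this

def clear (x : W ⊕ S.K) : Prog S W := .loop x Option.isSome fun _ => .skip

theorem Runs.clear (x : W ⊕ S.K) (s : Store S W) :
    Runs O qa (.clear x) s (Function.update s x []) ((s x).length + 1) := by
  generalize e : s x = l
  induction l generalizing s with
  | nil =>
    have := Runs.loop_exit (O := O) (qa := qa) (k := x) (c := Option.isSome)
      (f := fun _ => .skip) (s := s) (by simp [e])
    simpa [e, Prog.clear] using this
  | cons b l ih =>
    have h2 := ih (Function.update s x l) (by simp)
    have := Runs.loop_step (c := Option.isSome) (k := x) (f := fun _ => .skip)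
      (s := s) (by simp [e]) (Runs.skip _) (by simpa [e, Prog.clear] using h2)
    refine Runs.mono (s' := _) ?_ (show 0 + 1 + (l.length + 1) ≤ _ by
      simp only [List.length_cons]; omega)
    simpa [Prog.clear] using this

/-- Execute the programs of a list one after the other. -/
def seqAll (l : List (Prog S W)) : Prog S W := l.foldr .seq .skip

theorem Runs.seqAll (l : List (Prog S W)) (σ : ℕ → Store S W) (t : ℕ)
    (h : ∀ j (hj : j < l.length), Runs O qa l[j] (σ j) (σ (j + 1)) t) :
    Runs O qa (.seqAll l) (σ 0) (σ l.length) (l.length * t) := by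
  induction l generalizing σ with
  | nil => simpa [Prog.seqAll] using Runs.skip (σ 0)
  | cons p l ih =>
    have h1 := h 0 (by simp)
    have h2 := ih (fun j => σ (j + 1)) (fun j hj => h (j + 1) (by simpa using hj))
    refine (Runs.seq h1 h2).mono (le_of_eq ?_)
    simp only [List.length_cons]
    ring

/-- Without answers from the oracle, a program lengthens every stack by at most its running time. -/
theorem Runs.length_le {p : Prog S W} {s s' : Store S W} {t : ℕ}
    (h : Runs (fun _ => []) qa p s s' t) (k : W ⊕ S.K) : (s' k).length ≤ (s k).length + t := by
  let _ : Fintype p.Lbl := Fintype.ofFinite _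
  obtain ⟨u, hu, e⟩ := h qa (Option p.Lbl) inferInstance (entry p some none) (fun q =>
    match q with
    | none => .halt
    | some l => code p some none l) some none (fun l => rfl)
  have h1 := Machine.length_stk_le (M := frame S qa qa (Q := Option p.Lbl) (entry p some none)
    (fun q =>
    match q with
    | none => .halt
    | some l => code p some none l)) k u ⟨entry p some none, s⟩
  rw [e] at h1
  exact h1.trans (Nat.add_le_add_left hu _)

end Idioms

end Prog

/-! ### The stacks of the rounding algorithm -/

/-- The work stacks: `num` holds the number of variables in unary, `rows` and `cnt` the code and the
number of the rows produced so far, and `var p` the index of the variable at position `p` of a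
constraint; `aux` and `bak p` serve to restore `num` and `var p`. -/
inductive Stk (a : ℕ) : Type
  | inp | out | qry | ans | num | aux | cnt | rows | idx | tmp | res
  | var (p : Fin a)
  | bak (p : Fin a)
  deriving DecidableEq, Fintype

/-- A store as a record: changes of a stack become record updates, and equality of stores reduces to
equality of fields. -/
structure Mem (S : Machine) (a : ℕ) : Type where
  inp : List Bool
  out : List Bool
  qry : List Bool
  ans : List Bool
  num : List Bool
  aux : List Bool
  cnt : List Bool
  rows : List Bool
  idx : List Bool
  tmp : List Bool
  res : List Bool
  var : Fin a → List Bool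
  bak : Fin a → List Bool
  sub : S.K → List Bool

namespace Mem

variable {S : Machine} {a : ℕ}

def store (m : Mem S a) : Prog.Store S (Stk a)
  | .inl .inp => m.inp
  | .inl .out => m.out
  | .inl .qry => m.qry
  | .inl .ans => m.ans
  | .inl .num => m.num
  | .inl .aux => m.aux
  | .inl .cnt => m.cnt
  | .inl .rows => m.rows
  | .inl .idx => m.idx
  | .inl .tmp => m.tmp
  | .inl .res => m.res
  | .inl (.var p) => m.var p
  | .inl (.bak p) => m.bak p
  | .inr k => m.sub k

variable (m : Mem S a) (w : List Bool)

theorem update_inp : Function.update m.store (.inl .inp) w = {m with inp := w}.store := by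
  funext k; rcases k with (_ | _ | _ | _ | _ | _ | _ | _ | _ | _ | _ | _ | _) | _ <;> simp [store]

theorem update_out : Function.update m.store (.inl .out) w = {m with out := w}.store := by
  funext k; rcases k with (_ | _ | _ | _ | _ | _ | _ | _ | _ | _ | _ | _ | _) | _ <;> simp [store]

theorem update_qry : Function.update m.store (.inl .qry) w = {m with qry := w}.store := by
  funext k; rcases k with (_ | _ | _ | _ | _ | _ | _ | _ | _ | _ | _ | _ | _) | _ <;> simp [store]

theorem update_ans : Function.update m.store (.inl .ans) w = {m with ans := w}.store := by
  funext k; rcases k with (_ | _ | _ | _ | _ | _ | _ | _ | _ | _ | _ | _ | _) | _ <;> simp [store]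

theorem update_num : Function.update m.store (.inl .num) w = {m with num := w}.store := by
  funext k; rcases k with (_ | _ | _ | _ | _ | _ | _ | _ | _ | _ | _ | _ | _) | _ <;> simp [store]

theorem update_aux : Function.update m.store (.inl .aux) w = {m with aux := w}.store := by
  funext k; rcases k with (_ | _ | _ | _ | _ | _ | _ | _ | _ | _ | _ | _ | _) | _ <;> simp [store]

theorem update_cnt : Function.update m.store (.inl .cnt) w = {m with cnt := w}.store := by
  funext k; rcases k with (_ | _ | _ | _ | _ | _ | _ | _ | _ | _ | _ | _ | _) | _ <;> simp [store]

theorem update_rows : Function.update m.store (.inl .rows) w = {m with rows := w}.store := by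
  funext k; rcases k with (_ | _ | _ | _ | _ | _ | _ | _ | _ | _ | _ | _ | _) | _ <;> simp [store]

theorem update_idx : Function.update m.store (.inl .idx) w = {m with idx := w}.store := by
  funext k; rcases k with (_ | _ | _ | _ | _ | _ | _ | _ | _ | _ | _ | _ | _) | _ <;> simp [store]

theorem update_tmp : Function.update m.store (.inl .tmp) w = {m with tmp := w}.store := by
  funext k; rcases k with (_ | _ | _ | _ | _ | _ | _ | _ | _ | _ | _ | _ | _) | _ <;> simp [store]

theorem update_res : Function.update m.store (.inl .res) w = {m with res := w}.store := by
  funext k; rcases k with (_ | _ | _ | _ | _ | _ | _ | _ | _ | _ | _ | _ | _) | _ <;> simp [store]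

theorem update_var (p : Fin a) : Function.update m.store (.inl (.var p)) w =
    {m with var := Function.update m.var p w}.store := by
  funext k
  rcases k with (_ | _ | _ | _ | _ | _ | _ | _ | _ | _ | _ | q | _) | _ <;>
    simp [store, Function.update_apply]

theorem update_bak (p : Fin a) : Function.update m.store (.inl (.bak p)) w =
    {m with bak := Function.update m.bak p w}.store := by
  funext k
  rcases k with (_ | _ | _ | _ | _ | _ | _ | _ | _ | _ | _ | q | _) | _ <;>
    simp [store, Function.update_apply]

theorem update_sub (k : S.K) : Function.update m.store (.inr k) w =
    {m with sub := Function.update m.sub k w}.store := by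
  funext k
  rcases k with (_ | _ | _ | _ | _ | _ | _ | _ | _ | _ | _ | q | _) | _ <;>
    simp [store, Function.update_apply]

end Mem

/-- The program leads from the memory `m` to `m'` within `t` steps. -/
def Exec (O : Oracle) {S : Machine} {a : ℕ} (p : Prog S (Stk a)) (m m' : Mem S a) (t : ℕ) : Prop :=
  p.Runs O (.qry, .ans) m.store m'.store t

namespace Exec

variable {O : Oracle} {S : Machine} {a : ℕ} {p q : Prog S (Stk a)} {m m₁ m' m'' : Mem S a}
  {t t' : ℕ} {k y : Stk a ⊕ S.K} {c : Option Bool → Bool} {f : Option Bool → Prog S (Stk a)}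

theorem mono (h : Exec O p m m' t) (ht : t ≤ t') : Exec O p m m' t' := Prog.Runs.mono h ht

theorem skip : Exec O .skip m m 0 := Prog.Runs.skip _

theorem seq (h : Exec O p m m' t) (h' : Exec O q m' m'' t') : Exec O (.seq p q) m m'' (t + t') :=
  Prog.Runs.seq h h'

/-- The change of the store is a hypothesis rather than part of the conclusion, so that supplying an
`update` lemma of `Mem` determines `m'` by unification. -/
theorem push {b : Bool} (h : Function.update m.store k (b :: m.store k) = m'.store) :
    Exec O (.push k b) m m' 1 := by
  have := Prog.Runs.push (O := O) (qa := (.qry, .ans)) k b m.store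
  rwa [h] at this

theorem case (h₁ : Function.update m.store k (m.store k).tail = m₁.store)
    (h : Exec O (f (m.store k).head?) m₁ m' t) : Exec O (.case k f) m m' (t + 1) := by
  refine Prog.Runs.case ?_
  rw [h₁]
  exact h

theorem pushWord {w : List Bool} (h : Function.update m.store k (w.reverse ++ m.store k) = m'.store) :
    Exec O (.pushWord k w) m m' w.length := by
  have := Prog.Runs.pushWord (O := O) (qa := (.qry, .ans)) k w m.store
  rwa [h] at this

theorem move (hk : k ≠ y) (h₁ : Function.update m.store k [] = m₁.store)
    (h : Function.update m₁.store y ((m.store k).reverse ++ m.store y) = m'.store) :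
    Exec O (.move k y) m m' (2 * (m.store k).length + 1) := by
  have := Prog.Runs.move (O := O) (qa := (.qry, .ans)) hk m.store
  rwa [h₁, h] at this

theorem clear (h : Function.update m.store k [] = m'.store) :
    Exec O (.clear k) m m' ((m.store k).length + 1) := by
  have := Prog.Runs.clear (O := O) (qa := (.qry, .ans)) k m.store
  rwa [h] at this

/-- `σ j` is the memory at the head of the loop before iteration `j`, and `τ j` the memory just
after the pop there. -/
theorem loop_iterate (σ τ : ℕ → Mem S a) (n : ℕ)
    (hτ : ∀ j, Function.update (σ j).store k ((σ j).store k).tail = (τ j).store)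
    (hc : ∀ j < n, c ((σ j).store k).head? = true)
    (h : ∀ j < n, Exec O (f ((σ j).store k).head?) (τ j) (σ (j + 1)) t)
    (hn : c ((σ n).store k).head? = false) :
    Exec O (.loop k c f) (σ 0) (τ n) (n * (t + 1) + 1) := by
  have := Prog.Runs.loop_iterate (O := O) (qa := (.qry, .ans)) (k := k) (c := c) (f := f)
    (fun j => (σ j).store) n t hc (fun j hj => by rw [hτ]; exact h j hj) hn
  rwa [hτ] at this

theorem seqAll (l : List (Prog S (Stk a))) (σ : ℕ → Mem S a)
    (h : ∀ j (hj : j < l.length), Exec O l[j] (σ j) (σ (j + 1)) t) :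
    Exec O (.seqAll l) (σ 0) (σ l.length) (l.length * t) :=
  Prog.Runs.seqAll l (fun j => (σ j).store) t h

end Exec

/-! ### Registers -/

/-- `new` below position `j` and `old` from there on. -/
def blend {a : ℕ} {α : Type*} (new old : Fin a → α) (j : ℕ) (p : Fin a) : α :=
  if p.1 < j then new p else old p

section Blend

variable {a : ℕ} {α : Type*} (new old : Fin a → α)

theorem blend_zero : blend new old 0 = old := by
  funext p
  simp [blend]

theorem blend_of_le {j : ℕ} (hj : a ≤ j) : blend new old j = new := by
  funext p
  simp [blend, p.2.trans_le hj]

theorem blend_self (p : Fin a) : blend new old p p = old p := by simp [blend]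

theorem update_blend (p : Fin a) {x : α} (hx : x = new p) :
    Function.update (blend new old p) p x = blend new old (p + 1) := by
  subst hx
  funext q
  by_cases hq : q = p
  · subst hq; simp [blend]
  · have : q.1 ≠ p.1 := fun e => hq (Fin.ext e)
    simp only [Function.update_of_ne hq, blend]
    congr 1
    simp only [eq_iff_iff]
    omega

end Blend

/-- The contents of the registers that hold the positions `x` of the variables of a constraint. -/
def regs {a l : ℕ} (x : Fin l → ℕ) (p : Fin a) : List Bool :=
  if h : p.1 < l then encNat (x ⟨p, h⟩) else []

/-! ### Handling the registers. -/

section Programs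

variable {O : Oracle} {S : Machine} {a : ℕ}

/-- Execute a program for each position. -/
def forPos (f : Fin a → Prog S (Stk a)) : Prog S (Stk a) := .seqAll ((List.finRange a).map f)

theorem exec_forPos {f : Fin a → Prog S (Stk a)} (σ : ℕ → Mem S a) {t : ℕ}
    (h : ∀ p : Fin a, Exec O (f p) (σ p) (σ (p + 1)) t) :
    Exec O (forPos f) (σ 0) (σ a) (a * t) := by
  rw [forPos]
  have := Exec.seqAll (O := O) (t := t) ((List.finRange a).map f) σ fun j hj => by
    simpa using h ⟨j, by simpa using hj⟩
  simpa using this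

/-- Move the backups of the registers back. -/
def restore : Prog S (Stk a) := forPos fun p => .move (.inl (.bak p)) (.inl (.var p))

theorem exec_restore {m : Mem S a} (n : ℕ) (hv : m.var = fun _ => [])
    (hn : ∀ p, (m.bak p).length ≤ n) :
    Exec O restore m {m with var := fun p => (m.bak p).reverse, bak := fun _ => []}
      (a * (2 * n + 1)) := by
  have := exec_forPos (O := O) (S := S) (t := 2 * n + 1)
    (f := fun p => .move (.inl (.bak p)) (.inl (.var p)))
    (fun j => {m with
      var := blend (fun p => (m.bak p).reverse) m.var j
      bak := blend (fun _ => []) m.bak j}) (by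
      intro p
      refine (Exec.move (by simp) (Mem.update_bak _ _ _) ?_).mono ?_
      · rw [Mem.update_var]
        congr 2
        · refine update_blend _ _ p ?_
          simp [Mem.store, blend_self, hv]
        · exact update_blend _ _ p rfl
      · simp only [Mem.store, blend_self]
        have := hn p
        omega)
  simpa [blend_zero, blend_of_le, restore] using this

/-- Empty the registers. -/
def clearRegs : Prog S (Stk a) := forPos fun p => .clear (.inl (.var p))

theorem exec_clearRegs {m : Mem S a} (n : ℕ) (hn : ∀ p, (m.var p).length ≤ n) :
    Exec O clearRegs m {m with var := fun _ => []} (a * (n + 1)) := by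
  have := exec_forPos (O := O) (S := S) (t := n + 1)
    (f := fun p => .clear (.inl (.var p)))
    (fun j => {m with var := blend (fun _ => []) m.var j}) (by
      intro p
      refine (Exec.clear ?_).mono ?_
      · rw [Mem.update_var]
        congr 2
        exact update_blend _ _ p rfl
      · simp only [Mem.store, blend_self]
        have := hn p
        omega)
  simpa [blend_zero, blend_of_le, clearRegs] using this

/-- Pop the registers of a list, keeping backups, and collect the positions where the popped bit is
`false`, as these determine how to continue. -/
def probe (f : (Fin a → Bool) → Prog S (Stk a)) : List (Fin a) → (Fin a → Bool) → Prog S (Stk a)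
  | [], U => f U
  | p :: l, U => .case (.inl (.var p)) fun o =>
      match o with
      | none => probe f l U
      | some b => .seq (.push (.inl (.bak p)) b)
          (probe f l (if b then U else Function.update U p true))

/-- The program is a decision tree with a copy of `f U` at each leaf: the set `U` is remembered by
the control state alone. Empty registers are left alone and do not enter `U`. -/
theorem exec_probe {f : (Fin a → Bool) → Prog S (Stk a)} {l : List (Fin a)} (hl : l.Nodup)
    {U : Fin a → Bool} {m m' : Mem S a} {t : ℕ}
    (h : Exec O (f fun p => U p || (p ∈ l && (m.var p).head? == some false))
      {m with
        var := fun p => if p ∈ l then (m.var p).tail else m.var p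
        bak := fun p => if p ∈ l then (m.var p).head?.toList ++ m.bak p else m.bak p} m' t) :
    Exec O (probe f l U) m m' (t + 2 * l.length) := by
  induction l generalizing U m with
  | nil => simpa [probe] using h
  | cons p l ih =>
    obtain ⟨hp, hl⟩ := List.nodup_cons.1 hl
    refine (Exec.case (t := t + 2 * l.length + 1) (Mem.update_var _ _ _) ?_).mono
      (le_of_eq (by simp only [List.length_cons]; ring))
    change Exec O (match (m.var p).head? with
      | none => probe f l U
      | some b => .seq (.push (.inl (.bak p)) b)
          (probe f l (if b then U else Function.update U p true))) _ _ _
    cases e : m.var p with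
    | nil =>
      refine (ih hl ?_).mono (Nat.le_succ _)
      convert h using 2
      · funext q
        by_cases hq : q = p
        · subst hq; simp [hp, e]
        · simp [hq]
      · funext q
        by_cases hq : q = p
        · subst hq; simp [hp, e, Mem.store]
        · simp [hq]
      · funext q
        by_cases hq : q = p
        · subst hq; simp [hp, e]
        · simp [hq]
    | cons b r =>
      refine ((Exec.push (Mem.update_bak _ _ _)).seq (ih hl ?_)).mono
        (show 1 + (t + 2 * l.length) ≤ _ by omega)
      convert h using 2
      · funext q
        by_cases hq : q = p
        · subst hq; cases b <;> simp [hp, e]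
        · cases b <;> simp [hq]
      · funext q
        by_cases hq : q = p
        · subst hq; simp [hp, e, Mem.store]
        · simp [hq]
      · funext q
        by_cases hq : q = p
        · subst hq; simp [hp, e, Mem.store]
        · simp [hq]

end Programs

/-! ### Producing the rows of the integer system. -/

section Rows

variable {S : Machine} {a k l : ℕ}

/-- Code of the coefficients of a variable that occurs at the positions in `U`. -/
def coeffWord (r : Fin a → Fin k → ℤ) (U : Fin a → Bool) : List Bool :=
  (List.ofFn fun c => encInt (∑ p, if U p then r p c else 0)).flatten

/-- Produce a row of the integer system. -/
def rowProg (S : Machine) (r : Fin a → Fin k → ℤ) (b : ℤ) : Prog S (Stk a) :=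
  .seq (.loop (.inl .num) Option.isSome fun _ => .seq (.push (.inl .aux) true)
      (probe (fun U => .pushWord (.inl .rows) (coeffWord r U)) (List.finRange a) fun _ => false))
    (.seq (.pushWord (.inl .rows) (encInt b))
      (.seq (.push (.inl .cnt) true) (.seq (.move (.inl .aux) (.inl .num)) restore)))

/-- Round `j` pops bit `j` of every register, and a `false` there marks the positions of variable
`j`. The length bound on the registers ensures that they are exhausted after `n` rounds, so the
backups hold them entirely. The row is written reversed, as it is pushed on a stack. -/
theorem exec_rowProg (S : Machine) (r : Fin a → Fin k → ℤ) (b : ℤ) :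
    ∃ T, ∀ (O : Oracle) (m : Mem S a) (n : ℕ), m.num = List.replicate n true → m.aux = [] →
      m.bak = (fun _ => []) → (∀ p, (m.var p).length ≤ n) →
      Exec O (rowProg S r b) m {m with
        rows := ((List.range n).flatMap (fun j => coeffWord r fun p => (m.var p)[j]? == some false) ++
          encInt b).reverse ++ m.rows
        cnt := true :: m.cnt} (T * (n + 1)) := by
  -- There are only finitely many coefficient words, so the longest one bounds the cost of writing,
  -- independently of the input.
  let w := Finset.univ.sup fun U : Fin a → Bool => (coeffWord r U).length
  have hw : ∀ U, (coeffWord r U).length ≤ w := fun U =>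
    Finset.le_sup (f := fun U : Fin a → Bool => (coeffWord r U).length) (Finset.mem_univ U)
  refine ⟨w + 4 * a + (encInt b).length + 7, fun O m n hnum haux hbak hvar => ?_⟩
  -- The memory after `j` rounds: `j` bits of each register have moved, reversed, to its backup.
  let σ : ℕ → Mem S a := fun j => {m with
    num := List.replicate (n - j) true
    aux := List.replicate j true
    rows := ((List.range j).flatMap
      (fun j => coeffWord r fun p => (m.var p)[j]? == some false)).reverse ++ m.rows
    var := fun p => (m.var p).drop j
    bak := fun p => ((m.var p).take j).reverse}
  have h0 : σ 0 = m := by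
    simp only [σ, Nat.sub_zero, List.replicate_zero, List.range_zero, List.flatMap_nil,
      List.reverse_nil, List.nil_append, List.drop_zero, List.take_zero]
    rw [← hbak, ← hnum, ← haux]
  have h1 := Exec.loop_iterate (O := O) (k := .inl .num) (c := Option.isSome)
    (f := fun _ => .seq (.push (.inl .aux) true)
      (probe (fun U => .pushWord (.inl .rows) (coeffWord r U)) (List.finRange a) fun _ => false))
    σ (fun j => {σ j with num := List.replicate (n - j - 1) true}) n (t := 1 + (w + 2 * a))
    (fun j => by rw [Mem.update_num]; simp [Mem.store, σ])
    (fun j hj => by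
      have : n - j ≠ 0 := by omega
      simp [Mem.store, σ, List.head?_replicate, this])
    (fun j hj => by
      refine Exec.seq (Exec.push (Mem.update_aux _ _)) ?_
      have := exec_probe (O := O) (List.nodup_finRange a) (U := fun _ => false) (t := w)
        (m := {σ j with
          num := List.replicate (n - j - 1) true
          aux := true :: List.replicate j true}) (m' := σ (j + 1))
        (f := fun U => .pushWord (.inl .rows) (coeffWord r U)) (by
          refine Exec.mono (Exec.pushWord ?_) (hw _)
          rw [Mem.update_rows]
          congr 1
          simp only [σ, Mem.mk.injEq, true_and, and_true, Mem.store, List.mem_finRange, if_true,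
            List.replicate_succ, Nat.sub_sub]
          refine ⟨?_, ?_, ?_⟩
          · simp [List.range_succ, List.head?_drop]
          · funext p
            simp
          · funext p
            rw [List.head?_drop, List.take_add_one, List.reverse_append]
            cases (m.var p)[j]? <;> simp)
      rw [List.length_finRange] at this
      exact this)
    (by simp [Mem.store, σ])
  rw [h0] at h1
  refine ((h1.seq ((Exec.pushWord (Mem.update_rows _ _)).seq ((Exec.push (Mem.update_cnt _ _)).seq
    ((Exec.move (by simp) (Mem.update_aux _ _) (Mem.update_num _ _)).seq
      (m'' := {m with
        rows := ((List.range n).flatMap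
          (fun j => coeffWord r fun p => (m.var p)[j]? == some false) ++
            encInt b).reverse ++ m.rows
        cnt := true :: m.cnt}) (t' := a * (2 * n + 1)) ?_))))).mono ?_
  · have := exec_restore (O := O) (S := S) (a := a) (m := {σ n with
      num := List.replicate n true
      aux := []
      rows := (encInt b).reverse ++ (σ n).rows
      cnt := true :: m.cnt}) n (by
        funext p
        simp [σ, hvar p]) (by
        intro p
        simp [σ])
    convert this using 1
    · simp [σ, Mem.store]
    · simp only [Mem.mk.injEq, true_and, and_true, σ, hnum, haux, hbak]
      refine ⟨by simp, ?_⟩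
      funext p
      simp [List.take_of_length_le (hvar p)]
  · simp only [Mem.store, σ, List.length_replicate]
    nlinarith [Nat.zero_le ((encInt b).length * n)]

/-- Extend an inequality for tuples to all positions. -/
def padCoeff (a : ℕ) (r : Fin l × Fin k → ℤ) (p : Fin a) (c : Fin k) : ℤ :=
  if h : p.1 < l then r (⟨p, h⟩, c) else 0

/-- The only `false` in a unary code stands at the index that it encodes; this replaces any
comparison of numbers. -/
theorem getElem?_encNat (v j : ℕ) : (encNat v)[j]? = some false ↔ v = j := by
  rw [encNat, List.getElem?_append]
  split_ifs with h
  · simp only [List.length_replicate] at h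
    rw [List.getElem?_replicate, if_pos h]
    simp
    omega
  · simp only [List.length_replicate, not_lt] at h ⊢
    rw [List.getElem?_singleton]
    split_ifs <;> simp <;> omega

/-- Positions from `l` on have an empty register and coefficient `0`, so they do not contribute. -/
theorem coeffWord_regs (hl : l ≤ a) (r : Fin l × Fin k → ℤ) (x : Fin l → ℕ) (j : ℕ) :
    coeffWord (padCoeff a r) (fun p => (regs x p)[j]? == some false) =
      (List.ofFn fun c => encInt (varCoeff r x j c)).flatten := by
  rw [coeffWord]
  congr 2
  funext c
  congr 1
  rw [varCoeff]
  symm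
  refine Fintype.sum_of_injective (Fin.castLE hl) (Fin.castLE_injective hl) _ _ ?_ ?_
  · intro p hp
    have : ¬ p.1 < l := fun h => hp ⟨⟨p, h⟩, rfl⟩
    simp [padCoeff, this]
  · intro p
    simp [padCoeff, regs, getElem?_encNat]

/-- Produce the rows for the inequalities of a list, applied to the variables in the registers. -/
def rowsProg (S : Machine) (a : ℕ) (L : List (Ineq (Fin l × Fin k))) : Prog S (Stk a) :=
  .seqAll (L.map fun r => rowProg S (padCoeff a r.1) r.2)

/-- Column `j * k + c` is coordinate `c` of variable `j`, so a row is a concatenation of blocks of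
`k` coefficients, one block per variable. -/
theorem encRow_rowsAt (hl : l ≤ a) (n : ℕ) (r : Ineq (Fin l × Fin k)) (x : Fin l → ℕ) :
    encRow ((fun q => varCoeff r.1 x q.divNat q.modNat, r.2) : Ineq (Fin (n * k))) =
      (List.range n).flatMap (fun j => coeffWord (padCoeff a r.1)
        fun p => (regs x p)[j]? == some false) ++ encInt r.2 := by
  rw [encRow, List.ofFn_mul]
  congr 1
  rw [← List.map_coe_finRange_eq_range, List.flatMap_map, List.flatMap, ← List.ofFn_eq_map,
    List.flatten_flatten, List.map_ofFn]
  congr 2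
  funext j
  rw [coeffWord_regs hl]
  simp only [Function.comp]
  congr 2
  funext c
  have e : (⟨j * k + c, by nlinarith [j.2, c.2]⟩ : Fin (n * k)) = finProdFinEquiv (j, c) := by
    ext
    simp [finProdFinEquiv]
    ring
  have e' := finProdFinEquiv.symm_apply_apply (j, c)
  rw [e]
  rw [show (finProdFinEquiv (j, c)).divNat = j from congrArg Prod.fst e',
    show (finProdFinEquiv (j, c)).modNat = c from congrArg Prod.snd e']

/-- Each row program restores the registers, so the next one finds the same variables; the constants
`T` add up over the fixed list. -/
theorem exec_rowsProg (S : Machine) (hl : l ≤ a) (L : List (Ineq (Fin l × Fin k))) :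
    ∃ T, ∀ (O : Oracle) (m : Mem S a) (n : ℕ) (x : Fin l → ℕ), m.num = List.replicate n true →
      m.aux = [] → m.bak = (fun _ => []) → m.var = regs x → (∀ p, x p < n) →
      Exec O (rowsProg S a L) m {m with
        rows := ((rowsAt n L x).flatMap encRow).reverse ++ m.rows
        cnt := List.replicate L.length true ++ m.cnt} (T * (n + 1)) := by
  induction L with
  | nil =>
    refine ⟨0, fun O m n x _ _ _ _ _ => ?_⟩
    simpa [rowsProg, rowsAt, Prog.seqAll] using Exec.skip
  | cons r L ih =>
    obtain ⟨T, hT⟩ := ih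
    obtain ⟨T', hT'⟩ := exec_rowProg S (padCoeff a r.1) r.2
    refine ⟨T' + T, fun O m n x hnum haux hbak hvar hx => ?_⟩
    have hlen : ∀ p, (m.var p).length ≤ n := by
      intro p
      rw [hvar, regs]
      split_ifs with h
      · simpa [encNat] using hx ⟨p, h⟩
      · simp
    have h1 := hT' O m n hnum haux hbak hlen
    have h2 := h1.seq (hT O _ n x hnum haux hbak hvar hx)
    rw [add_mul]
    refine Eq.mp (congrArg (fun z => Exec O _ m z _) ?_) h2
    simp only [Mem.mk.injEq, true_and, and_true]
    constructor
    · simp [List.replicate_succ']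
    · simp only [rowsAt, List.map_cons, List.flatMap_cons, encRow_rowsAt hl, hvar,
        List.reverse_append, List.append_assoc]

end Rows

theorem Exec.conv {O : Oracle} {S : Machine} {a t t' : ℕ} {m m' m₁ m₂ : Mem S a}
    {p : Prog S (Stk a)} (h : Exec O p m₁ m₂ t) (h₁ : m = m₁) (h₂ : m₂ = m') (ht : t ≤ t') :
    Exec O p m m' t' := by
  subst h₁ h₂
  exact h.mono ht

theorem Exec.loop_exit {O : Oracle} {S : Machine} {a : ℕ} {m m' : Mem S a} {k : Stk a ⊕ S.K}
    {c : Option Bool → Bool} {f : Option Bool → Prog S (Stk a)}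
    (h₁ : Function.update m.store k (m.store k).tail = m'.store) (hc : c (m.store k).head? = false) :
    Exec O (.loop k c f) m m' 1 := by
  have := Prog.Runs.loop_exit (O := O) (qa := (.qry, .ans)) (f := f) hc
  rwa [h₁] at this

theorem Exec.loop_step {O : Oracle} {S : Machine} {a t t' : ℕ} {m m₁ m' m'' : Mem S a}
    {k : Stk a ⊕ S.K} {c : Option Bool → Bool} {f : Option Bool → Prog S (Stk a)}
    (h₁ : Function.update m.store k (m.store k).tail = m₁.store) (hc : c (m.store k).head? = true)
    (h : Exec O (f (m.store k).head?) m₁ m' t) (h' : Exec O (.loop k c f) m' m'' t') :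
    Exec O (.loop k c f) m m'' (t + 1 + t') := by
  refine Prog.Runs.loop_step hc ?_ h'
  rw [h₁]
  exact h

/-! ### Parsing the input. -/

section Reading

variable {O : Oracle} {S : Machine} {a k l : ℕ}

theorem encNat_succ (n : ℕ) : encNat (n + 1) = true :: encNat n := by
  simp [encNat, List.replicate_succ]

/-- Run through a unary number on the input stack. -/
theorem exec_loop_encNat {f : Option Bool → Prog S (Stk a)} {n : ℕ} {rest : List Bool} {t : ℕ}
    (σ : ℕ → Mem S a) (h : ∀ j < n, ∀ w, Exec O (f (some true)) {σ j with inp := w}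
      {σ (j + 1) with inp := w} t) :
    Exec O (.loop (.inl .inp) (· == some true) f) {σ 0 with inp := encNat n ++ rest}
      {σ n with inp := rest} (n * (t + 1) + 1) := by
  induction n generalizing σ with
  | zero =>
    exact (Exec.loop_exit (Mem.update_inp _ _) (by simp [Mem.store, encNat])).mono (by simp)
  | succ n ih =>
    rw [encNat_succ]
    refine (Exec.loop_step (Mem.update_inp _ _) (by simp [Mem.store])
      (h 0 (by omega) _) (ih (fun j => σ (j + 1)) fun j hj => h _ (by omega))).mono
      (le_of_eq (by ring))

/-- Read the number of variables. -/
def readNum (S : Machine) (a : ℕ) : Prog S (Stk a) :=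
  .loop (.inl .inp) (· == some true) fun _ => .seq (.push (.inl .num) true) (.push (.inl .idx) true)

theorem exec_readNum {m : Mem S a} {n : ℕ} {rest : List Bool} (hinp : m.inp = encNat n ++ rest)
    (hnum : m.num = []) (hidx : m.idx = []) :
    Exec O (readNum S a) m {m with
      inp := rest
      num := List.replicate n true
      idx := List.replicate n true} (n * 3 + 1) := by
  have := exec_loop_encNat (O := O) (n := n) (rest := rest) (t := 2)
    (f := fun _ => .seq (.push (.inl .num) true) (.push (.inl .idx) true))
    (fun j => {m with num := List.replicate j true, idx := List.replicate j true})
    (fun j hj w => (Exec.push (Mem.update_num _ _)).seq (Exec.push (Mem.update_idx _ _)))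
  refine this.conv ?_ rfl le_rfl
  cases m
  simp_all

/-- Read a position of a variable into a register. -/
def readReg (p : Fin a) : Prog S (Stk a) :=
  .seq (.push (.inl (.var p)) false)
    (.loop (.inl .inp) (· == some true) fun _ => .push (.inl (.var p)) true)

/-- The terminating `false` is pushed first and the `true`s on top of it, so the register holds the
code in the right order. -/
theorem exec_readReg {p : Fin a} {m : Mem S a} {v : ℕ} {rest : List Bool}
    (hinp : m.inp = encNat v ++ rest) (hvar : m.var p = []) :
    Exec O (readReg p) m {m with inp := rest, var := Function.update m.var p (encNat v)}
      (1 + (v * 2 + 1)) := by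
  refine Exec.seq (Exec.push (Mem.update_var _ _ _)) ?_
  have := exec_loop_encNat (O := O) (n := v) (rest := rest) (t := 1)
    (f := fun _ => .push (.inl (.var p)) true)
    (fun j => {m with var := Function.update m.var p (encNat j)})
    (fun j hj w => Exec.push (by
      rw [Mem.update_var]
      simp [Mem.store, encNat_succ]))
  rw [← hinp] at this
  simpa [Mem.store, hvar, encNat] using this

/-- Read the positions of `l` variables into the registers. -/
def readRegs (S : Machine) (a l : ℕ) : Prog S (Stk a) :=
  forPos fun p => if p.1 < l then readReg p else .skip

theorem exec_readRegs (hl : l ≤ a) {m : Mem S a} {n : ℕ} {x : Fin l → ℕ} (hx : ∀ p, x p < n)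
    {rest : List Bool} (hinp : m.inp = (List.ofFn fun p => encNat (x p)).flatten ++ rest)
    (hvar : m.var = fun _ => []) :
    Exec O (readRegs S a l) m {m with inp := rest, var := regs x} (a * (2 * n + 2)) := by
  have := exec_forPos (O := O) (S := S) (t := 2 * n + 2)
    (f := fun p => if p.1 < l then readReg p else .skip)
    (fun j => {m with
      inp := ((List.ofFn fun p => encNat (x p)).drop j).flatten ++ rest
      var := blend (regs x) m.var j}) (by
      intro p
      by_cases hp : p.1 < l
      · simp only [hp, if_true]
        have hd : (List.ofFn fun p => encNat (x p)).drop p =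
            encNat (x ⟨p, hp⟩) :: (List.ofFn fun p => encNat (x p)).drop (p + 1) := by
          rw [List.drop_eq_getElem_cons (by simpa using hp)]
          simp
        refine (exec_readReg (O := O) (p := p) (m := {m with
          inp := ((List.ofFn fun p => encNat (x p)).drop p).flatten ++ rest
          var := blend (regs x) m.var p}) (v := x ⟨p, hp⟩)
          (rest := ((List.ofFn fun p => encNat (x p)).drop (p + 1)).flatten ++ rest)
          ?_ ?_).conv rfl ?_ ?_
        · simp [hd]
        · simp [blend_self, hvar]
        · simp only [Mem.mk.injEq, true_and, and_true]
          exact update_blend _ _ p (by simp [regs, hp])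
        · have := hx ⟨p, hp⟩
          omega
      · simp only [hp, if_false]
        refine Exec.skip.conv rfl ?_ (Nat.zero_le _)
        simp only [Mem.mk.injEq, true_and, and_true]
        refine ⟨?_, ?_⟩
        · rw [List.drop_of_length_le (by simpa using hp),
            List.drop_of_length_le (by simp; omega)]
        · rw [← update_blend _ _ p (x := []) (by simp [regs, hp]), eq_comm,
            Function.update_eq_self_iff]
          simp [blend_self, hvar])
  simp only [List.drop_zero, blend_zero, blend_of_le _ _ le_rfl] at this
  rw [← hinp, List.drop_of_length_le (by simpa using hl)] at this
  simpa [readRegs] using this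

/-- Produce the rows for a constraint whose relation is given by a list of inequalities. -/
def constraintProg (S : Machine) (a : ℕ) (L : List (Ineq (Fin l × Fin k))) : Prog S (Stk a) :=
  .seq (readRegs S a l) (.seq (rowsProg S a L) clearRegs)

theorem exec_constraintProg (S : Machine) (hl : l ≤ a) (L : List (Ineq (Fin l × Fin k))) :
    ∃ T, ∀ (O : Oracle) (m : Mem S a) (n : ℕ) (x : Fin l → ℕ) (rest : List Bool),
      m.num = List.replicate n true → m.aux = [] → m.bak = (fun _ => []) →
      m.var = (fun _ => []) → (∀ p, x p < n) →
      m.inp = (List.ofFn fun p => encNat (x p)).flatten ++ rest →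
      Exec O (constraintProg S a L) m {m with
        inp := rest
        rows := ((rowsAt n L x).flatMap encRow).reverse ++ m.rows
        cnt := List.replicate L.length true ++ m.cnt} (T * (n + 1)) := by
  obtain ⟨T, hT⟩ := exec_rowsProg S hl L
  refine ⟨2 * a + T + a, fun O m n x rest hnum haux hbak hvar hx hinp => ?_⟩
  have h1 := exec_readRegs (O := O) hl hx hinp hvar
  have h2 := hT O {m with inp := rest, var := regs x} n x hnum haux hbak rfl hx
  have h3 := exec_clearRegs (O := O) (m := {m with
    inp := rest
    var := regs x
    rows := ((rowsAt n L x).flatMap encRow).reverse ++ m.rows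
    cnt := List.replicate L.length true ++ m.cnt}) n (by
      intro p
      simp only [regs]
      split_ifs with h
      · simpa [encNat] using hx ⟨p, h⟩
      · simp)
  refine (h1.seq (h2.seq h3)).conv rfl ?_ (le_of_eq (by ring))
  simp [hvar]

/-- Read a unary number and execute the program at this position of a list. -/
def switch : List (Prog S (Stk a)) → Prog S (Stk a)
  | [] => .skip
  | p :: l => .case (.inl .inp) fun o => if o = some true then switch l else p

theorem exec_switch {l : List (Prog S (Stk a))} {j : ℕ} (hj : j < l.length) {m m' : Mem S a}
    {rest : List Bool} {t : ℕ} (hinp : m.inp = encNat j ++ rest)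
    (h : Exec O l[j] {m with inp := rest} m' t) : Exec O (switch l) m m' (t + (j + 1)) := by
  induction l generalizing j m with
  | nil => simp at hj
  | cons p l ih =>
    cases j with
    | zero =>
      refine Exec.case (Mem.update_inp _ _) ?_
      simpa [Mem.store, hinp, encNat] using h
    | succ j =>
      rw [encNat_succ] at hinp
      have := ih (j := j) (by simpa using hj) (m := {m with inp := encNat j ++ rest}) rfl
        (by simpa using h)
      refine Exec.case (t := t + (j + 1)) (Mem.update_inp _ _) ?_
      simpa [Mem.store, hinp] using this

end Reading

/-! ### Building the whole system and passing it to the solver. -/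

section Build

variable {S : Machine} {a k : ℕ}

theorem length_rowsAt (n : ℕ) {l : ℕ} (L : List (Ineq (Fin l × Fin k))) (x : Fin l → ℕ) :
    (rowsAt n L x).length = L.length := by simp [rowsAt]

/-- Produce the rows for the individual variables. -/
def domainProg (S : Machine) (p₀ : Fin a) (L : List (Ineq (Fin 1 × Fin k))) : Prog S (Stk a) :=
  .seq (.push (.inl (.var p₀)) false)
    (.seq (.loop (.inl .idx) Option.isSome fun _ =>
      .seq (rowsProg S a L) (.push (.inl (.var p₀)) true)) clearRegs)

/-- The register `p₀` runs through the variables: one more `true` on top turns the code of `j` into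
that of `j + 1`, while `idx` counts down. -/
theorem exec_domainProg (S : Machine) {p₀ : Fin a} (hp : p₀.1 = 0)
    (L : List (Ineq (Fin 1 × Fin k))) :
    ∃ T, ∀ (O : Oracle) (m : Mem S a) (n : ℕ),
      m.num = List.replicate n true → m.aux = [] → m.bak = (fun _ => []) →
      m.var = (fun _ => []) → m.idx = List.replicate n true →
      Exec O (domainProg S p₀ L) m {m with
        idx := []
        rows := (((List.range n).flatMap fun i => rowsAt n L fun _ => i).flatMap encRow).reverse ++
          m.rows
        cnt := List.replicate ((List.range n).flatMap fun i => rowsAt n L fun _ => i).length true ++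
          m.cnt} (T * (n + 1) * (n + 1)) := by
  have ha : 1 ≤ a := by have := p₀.2; omega
  obtain ⟨T, hT⟩ := exec_rowsProg S ha L
  refine ⟨T + 2 * a + 4, fun O m n hnum haux hbak hvar hidx => ?_⟩
  have hregs : ∀ (j : ℕ) (b : List Bool), Function.update (regs (a := a) fun _ : Fin 1 => j) p₀ b =
      fun p => if p = p₀ then b else [] := by
    intro j b
    funext p
    by_cases h : p = p₀
    · simp [h]
    · have : p.1 ≠ 0 := fun e => h (Fin.ext (e.trans hp.symm))
      simp [h, regs, this]
  have hregs' : ∀ j : ℕ, regs (a := a) (fun _ : Fin 1 => j) =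
      fun p => if p = p₀ then encNat j else [] := by
    intro j
    rw [← hregs j, eq_comm, Function.update_eq_self_iff]
    simp [regs, hp]
  let σ : ℕ → Mem S a := fun j => {m with
    idx := List.replicate (n - j) true
    var := regs fun _ : Fin 1 => j
    rows := (((List.range j).flatMap fun i => rowsAt n L fun _ => i).flatMap encRow).reverse ++
      m.rows
    cnt := List.replicate ((List.range j).flatMap fun i => rowsAt n L fun _ => i).length true ++
      m.cnt}
  have h1 : Exec O (.push (.inl (.var p₀)) false) m (σ 0) 1 := by
    refine (Exec.push (Mem.update_var _ _ _)).conv rfl ?_ le_rfl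
    simp only [σ, Mem.mk.injEq, true_and, and_true]
    refine ⟨by simp, by simp, by simp [hidx], ?_⟩
    rw [hregs']
    funext p
    simp [Function.update_apply, Mem.store, hvar, encNat]
  have h2 := Exec.loop_iterate (O := O) (k := .inl .idx) (c := Option.isSome)
    (f := fun _ => .seq (rowsProg S a L) (.push (.inl (.var p₀)) true))
    σ (fun j => {σ j with idx := List.replicate (n - j - 1) true}) n (t := T * (n + 1) + 1)
    (fun j => by rw [Mem.update_idx]; simp [Mem.store, σ])
    (fun j hj => by
      have : n - j ≠ 0 := by omega
      simp [Mem.store, σ, List.head?_replicate, this])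
    (fun j hj => by
      have h3 := hT O {σ j with idx := List.replicate (n - j - 1) true} n (fun _ => j)
        hnum haux hbak rfl (fun _ => hj)
      refine (h3.seq (Exec.push (Mem.update_var _ _ _))).conv rfl ?_ le_rfl
      simp only [σ, Mem.mk.injEq, true_and, and_true, Nat.sub_sub]
      refine ⟨?_, ?_, ?_⟩
      · rw [← List.append_assoc, List.replicate_append_replicate, Nat.add_comm, List.range_succ,
          List.flatMap_append, List.length_append]
        simp [length_rowsAt]
      · simp [List.range_succ]
      · rw [hregs, hregs' (j + 1)]
        simp [Mem.store, regs, hp, encNat_succ])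
    (by simp [Mem.store, σ])
  -- After the last round `p₀` holds the code of `n`, of length `n + 1`.
  have h3 := exec_clearRegs (O := O) (m := {σ n with idx := List.replicate (n - n - 1) true})
    (n + 1) (by
      intro p
      simp only [σ, hregs']
      split_ifs <;> simp [encNat])
  refine (h1.seq (h2.seq h3)).conv rfl ?_ ?_
  · simp [σ, hvar]
  · nlinarith [Nat.zero_le (a * n * n), Nat.zero_le (a * n), Nat.zero_le (T * n)]

variable {I : Type*} [Fintype I] {ar : I → ℕ}

/-- Code of the constraints of a formula. -/
noncomputable def encConstraints {n : ℕ} (cs : List (Σ i : I, Fin (ar i) → Fin n)) : List Bool :=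
  cs.flatMap fun c => true :: (encFin c.1 ++ (List.ofFn fun j => encNat (c.2 j)).flatten)

/-- Produce the rows for the constraints. -/
noncomputable def constraintsProg (S : Machine) (a : ℕ) (L : ∀ i, List (Ineq (Fin (ar i) × Fin k))) :
    Prog S (Stk a) :=
  .loop (.inl .inp) (· == some true) fun _ =>
    switch (List.ofFn fun e : Fin (Fintype.card I) =>
      constraintProg S a (L ((Fintype.equivFin I).symm e)))

theorem exec_constraintsProg (S : Machine) (ha : ∀ i, ar i ≤ a)
    (L : ∀ i, List (Ineq (Fin (ar i) × Fin k))) :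
    ∃ T, ∀ (O : Oracle) (n : ℕ) (cs : List (Σ i : I, Fin (ar i) → Fin n)) (m : Mem S a),
      m.num = List.replicate n true → m.aux = [] → m.bak = (fun _ => []) →
      m.var = (fun _ => []) → m.inp = encConstraints cs ++ [false] →
      Exec O (constraintsProg S a L) m {m with
        inp := []
        rows := ((cs.flatMap fun c => rowsAt n (L c.1) fun p => c.2 p).flatMap encRow).reverse ++
          m.rows
        cnt := List.replicate (cs.flatMap fun c => rowsAt n (L c.1) fun p => c.2 p).length true ++
          m.cnt} (cs.length * (T * (n + 1)) + 1) := by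
  choose T hT using fun i => exec_constraintProg S (ha i) (L i)
  -- The sum covers whichever symbol occurs, and `Fintype.card I` the reading of its index.
  refine ⟨∑ i, T i + Fintype.card I + 1, fun O n cs => ?_⟩
  induction cs with
  | nil =>
    intro m hnum haux hbak hvar hinp
    refine (Exec.loop_exit (Mem.update_inp _ _) ?_).conv rfl ?_ (by simp)
    · simp [Mem.store, hinp, encConstraints]
    · simp [Mem.store, hinp, encConstraints]
  | cons c cs ih =>
    intro m hnum haux hbak hvar hinp
    let m₁ : Mem S a := {m with
      inp := encConstraints cs ++ [false]
      rows := ((rowsAt n (L c.1) fun p => c.2 p).flatMap encRow).reverse ++ m.rows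
      cnt := List.replicate (L c.1).length true ++ m.cnt}
    have hinp' : m.inp = true :: (encNat (Fintype.equivFin I c.1) ++
        ((List.ofFn fun j => encNat (c.2 j)).flatten ++ (encConstraints cs ++ [false]))) := by
      rw [hinp]
      simp [encConstraints, encFin]
    have h1 : Exec O (switch (List.ofFn fun e : Fin (Fintype.card I) =>
        constraintProg S a (L ((Fintype.equivFin I).symm e)))) {m with
          inp := encNat (Fintype.equivFin I c.1) ++
            ((List.ofFn fun j => encNat (c.2 j)).flatten ++ (encConstraints cs ++ [false]))} m₁
        (T c.1 * (n + 1) + (Fintype.equivFin I c.1 + 1)) := by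
      refine exec_switch (by simp) rfl ?_
      have := hT c.1 O {m with inp := (List.ofFn fun j => encNat (c.2 j)).flatten ++
        (encConstraints cs ++ [false])} n (fun p => c.2 p) (encConstraints cs ++ [false]) hnum haux
        hbak hvar (fun p => (c.2 p).2) rfl
      convert this using 1
      simp only [List.getElem_ofFn, Fin.eta]
      rw [Equiv.symm_apply_apply]
    have h2 := ih m₁ hnum haux hbak hvar rfl
    have hT' : T c.1 ≤ ∑ i, T i := Finset.single_le_sum (fun _ _ => Nat.zero_le _) (Finset.mem_univ _)
    have hc := (Fintype.equivFin I c.1).2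
    refine (Exec.loop_step (m₁ := {m with
          inp := encNat (Fintype.equivFin I c.1) ++
            ((List.ofFn fun j => encNat (c.2 j)).flatten ++ (encConstraints cs ++ [false]))})
      ?_ ?_ h1 h2).conv rfl ?_ ?_
    · rw [Mem.update_inp]
      simp [Mem.store, hinp']
    · simp [Mem.store, hinp']
    · simp only [m₁, Mem.mk.injEq, true_and, and_true]
      refine ⟨?_, ?_⟩
      · rw [← List.append_assoc, List.replicate_append_replicate, Nat.add_comm, List.flatMap_cons,
          List.length_append, length_rowsAt]
      · simp
    · simp only [List.length_cons]
      have h3 := Nat.mul_le_mul_right (n + 1) hT'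
      nlinarith [Nat.zero_le (Fintype.card I * n)]

/-- Hand the integer system over to the subroutine. -/
def assemble (S : Machine) (a k : ℕ) : Prog S (Stk a) :=
  .seq (.move (.inl .rows) (.inr S.inp)) <| .seq (.push (.inr S.inp) false) <|
    .seq (.loop (.inl .num) Option.isSome fun _ => .seq (.push (.inl .aux) true)
      (.pushWord (.inr S.inp) (List.replicate k true))) <|
    .seq (.push (.inr S.inp) false) <|
    .seq (.move (.inl .cnt) (.inr S.inp)) (.move (.inl .aux) (.inl .num))

/-- The code is pushed from its end to its beginning, since the number of rows, which comes first in
it, is known only now. Moving `rows` undoes the reversal. Pushing `k` bits per variable multiplies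
`n` by `k`, and `aux` preserves `n` for the rounding. -/
theorem exec_assemble (O : Oracle) {m : Mem S a} {n r : ℕ} {w : List Bool}
    (hnum : m.num = List.replicate n true) (haux : m.aux = []) (hsub : m.sub = fun _ => [])
    (hrows : m.rows = w.reverse) (hcnt : m.cnt = List.replicate r true) :
    Exec O (assemble S a k) m {m with
      rows := []
      cnt := []
      sub := Function.update (fun _ => []) S.inp (encNat r ++ encNat (n * k) ++ w)}
      (2 * w.length + 2 * r + n * (k + 4) + 6) := by
  let σ : ℕ → Mem S a := fun j => {m with
    rows := []
    num := List.replicate (n - j) true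
    aux := List.replicate j true
    sub := Function.update (fun _ => []) S.inp (List.replicate (j * k) true ++ false :: w)}
  have h1 := Exec.move (O := O) (k := .inl .rows) (y := .inr S.inp) (by simp)
    (Mem.update_rows m _) (Mem.update_sub _ _ _)
  have h2 : Exec O (.push (.inr S.inp) false) {m with
      rows := []
      sub := Function.update (fun _ => []) S.inp w} (σ 0) 1 := by
    refine (Exec.push (Mem.update_sub _ _ _)).conv rfl ?_ le_rfl
    simp [σ, Mem.store, hnum, haux]
  have h3 := Exec.loop_iterate (O := O) (k := .inl .num) (c := Option.isSome)
    (f := fun _ => .seq (.push (.inl .aux) true)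
      (.pushWord (.inr S.inp) (List.replicate k true)))
    σ (fun j => {σ j with num := List.replicate (n - j - 1) true}) n (t := k + 1)
    (fun j => by rw [Mem.update_num]; simp [Mem.store, σ])
    (fun j hj => by
      have : n - j ≠ 0 := by omega
      simp [Mem.store, σ, List.head?_replicate, this])
    (fun j hj => by
      refine ((Exec.push (Mem.update_aux _ _)).seq (Exec.pushWord (Mem.update_sub _ _ _))).conv rfl
        ?_ (by simp [add_comm])
      simp only [σ, Mem.mk.injEq, true_and, Nat.sub_sub]
      refine ⟨by simp [Mem.store, List.replicate_succ], ?_⟩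
      rw [Function.update_idem]
      congr 1
      simp only [Mem.store, List.reverse_replicate, Function.update_self]
      rw [← List.append_assoc, List.replicate_append_replicate, Nat.add_mul, one_mul, add_comm])
    (by simp [Mem.store, σ])
  refine ((h1.conv rfl ?_ le_rfl).seq (h2.seq (h3.seq ((Exec.push (Mem.update_sub _ _ _)).seq
    ((Exec.move (by simp) (Mem.update_cnt _ _) (Mem.update_sub _ _ _)).seq
      (Exec.move (by simp) (Mem.update_aux _ _) (Mem.update_num _ _))))))).conv rfl ?_ ?_
  · simp [Mem.store, hrows, hsub]
  · simp only [σ, Mem.mk.injEq, true_and, Mem.store]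
    refine ⟨by simp [hnum], by simp [haux], ?_⟩
    simp [hcnt, encNat]
  · simp only [Mem.store, σ, hrows, hcnt, List.length_reverse, List.length_replicate]
    nlinarith

end Build

/-! ### Querying the oracle on the solution. -/

section Rounding

variable {O : Oracle} {S : Machine} {a k : ℕ}

/-- The initial memory. -/
def Mem.init (S : Machine) (a : ℕ) (x : List Bool) : Mem S a where
  inp := x
  out := []
  qry := []
  ans := []
  num := []
  aux := []
  cnt := []
  rows := []
  idx := []
  tmp := []
  res := []
  var := fun _ => []
  bak := fun _ => []
  sub := fun _ => []

theorem Mem.store_init (S : Machine) (a : ℕ) (x : List Bool) :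
    (Mem.init S a x).store = Function.update (fun _ => []) (.inl .inp) x := by
  funext k
  rcases k with (_ | _ | _ | _ | _ | _ | _ | _ | _ | _ | _ | _ | _) | _ <;>
    simp [Mem.store, Mem.init]

theorem Exec.outputs {p : Prog S (Stk a)} {x : List Bool} {m : Mem S a} {t : ℕ}
    (h : Exec O p (Mem.init S a x) m t) :
    (p.toMachine (.inp, .out) (.qry, .ans)).Outputs O x m.out t := by
  rw [Exec, Mem.store_init] at h
  exact Prog.Runs.outputs (io := (Stk.inp, Stk.out)) h

theorem Exec.run (hS : S.OracleFree) {m : Mem S a} {x y : List Bool} {t : ℕ}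
    (hm : m.sub = Function.update (fun _ => []) S.inp x) (h : S.Outputs (fun _ => []) x y t) :
    ∃ σ : S.K → List Bool, σ S.out = y ∧ Exec O .run m {m with sub := σ} t := by
  obtain ⟨σ, hσ, hr⟩ := Prog.Runs.run (O := O) (qa := (.qry, .ans)) (s := m.store) hS
    (fun k => congrFun hm k) h
  refine ⟨σ, hσ, ?_⟩
  rw [Exec]
  convert hr using 1
  funext k
  rcases k with (_ | _ | _ | _ | _ | _ | _ | _ | _ | _ | _ | _ | _) | _ <;> rfl

theorem encStr_cons (b : Bool) (w : List Bool) : encStr (b :: w) = true :: b :: encStr w := by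
  simp [encStr]

theorem length_encStr (w : List Bool) : (encStr w).length = 2 * w.length + 1 := by
  induction w with
  | nil => simp [encStr]
  | cons b w ih => rw [encStr_cons, List.length_cons, List.length_cons, ih, List.length_cons]; ring

/-- Copy a self-delimiting word from the output of the subroutine. -/
def copyWord (S : Machine) (a : ℕ) : Prog S (Stk a) :=
  .seq (.loop (.inr S.out) (· == some true) fun _ => .seq (.push (.inl .tmp) true)
    (.case (.inr S.out) fun o => .push (.inl .tmp) (o.getD false))) (.push (.inl .tmp) false)

theorem exec_copyWord {m : Mem S a} {w rest : List Bool} (hm : m.sub S.out = encStr w ++ rest) :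
    Exec O (copyWord S a) m {m with
      tmp := (encStr w).reverse ++ m.tmp
      sub := Function.update m.sub S.out rest} (4 * w.length + 2) := by
  have key : Exec O (.loop (.inr S.out) (· == some true) fun _ => .seq (.push (.inl .tmp) true)
      (.case (.inr S.out) fun o => .push (.inl .tmp) (o.getD false))) m {m with
        tmp := (w.flatMap fun b => [true, b]).reverse ++ m.tmp
        sub := Function.update m.sub S.out rest} (4 * w.length + 1) := by
    induction w generalizing m with
    | nil =>
      refine (Exec.loop_exit (Mem.update_sub _ _ _) ?_).conv rfl ?_ (by simp)
      · simp [Mem.store, hm, encStr]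
      · simp [Mem.store, hm, encStr]
    | cons b w ih =>
      rw [encStr_cons] at hm
      have h1 := ih (m := {m with
        tmp := b :: true :: m.tmp
        sub := Function.update m.sub S.out (encStr w ++ rest)}) (by simp)
      refine (Exec.loop_step (Mem.update_sub _ _ _) ?_
        ((Exec.push (Mem.update_tmp _ _)).seq (Exec.case (Mem.update_sub _ _ _)
          (m' := {m with
            tmp := b :: true :: m.tmp
            sub := Function.update m.sub S.out (encStr w ++ rest)}) (t := 1) ?_)) h1).conv rfl ?_ ?_
      · simp [Mem.store, hm]
      · refine (Exec.push (Mem.update_tmp _ _)).conv rfl ?_ le_rfl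
        simp [Mem.store, hm]
      · simp
      · simp only [List.length_cons]; omega
  refine (key.seq (Exec.push (Mem.update_tmp _ _))).conv rfl ?_ le_rfl
  simp [Mem.store, encStr]

/-- The cost `4 * w.length + 2` of copying a word is twice the length of its code, so the total is
linear in the text copied. -/
theorem exec_copyWords {ws : List (List Bool)} {m : Mem S a} {rest : List Bool}
    (hm : m.sub S.out = ws.flatMap encStr ++ rest) :
    Exec O (.seqAll (List.replicate ws.length (copyWord S a))) m {m with
      tmp := (ws.flatMap encStr).reverse ++ m.tmp
      sub := Function.update m.sub S.out rest} (2 * (ws.flatMap encStr).length) := by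
  induction ws generalizing m with
  | nil =>
    refine Exec.skip.conv rfl ?_ le_rfl
    cases m
    simp only [List.flatMap_nil, List.nil_append] at hm
    simp [← hm]
  | cons w ws ih =>
    rw [List.flatMap_cons, List.append_assoc] at hm
    refine ((exec_copyWord hm).seq (ih (m := {m with
      tmp := (encStr w).reverse ++ m.tmp
      sub := Function.update m.sub S.out (ws.flatMap encStr ++ rest)}) (by simp))).conv rfl ?_ ?_
    · simp
    · simp only [List.flatMap_cons, List.length_append, length_encStr]
      omega

/-- Round the value of one variable. -/
def roundVar (S : Machine) (a k : ℕ) : Prog S (Stk a) :=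
  .seq (.seqAll (List.replicate k (copyWord S a))) (.seq (.move (.inl .tmp) (.inl .qry))
    (.seq .query (.move (.inl .ans) (.inl .res))))

theorem Exec.query {m : Mem S a} :
    Exec O .query m {m with qry := [], ans := O m.qry} 1 := by
  have := Prog.Runs.query (O := O) (qa := (.qry, .ans)) m.store
  simp only [Mem.update_qry, Mem.update_ans] at this
  exact this

/-- Copying reverses the code of the point, and the move to `qry` reverses it back, so the oracle
sees exactly the code of a tuple. The answer is stored reversed in `res`. -/
theorem exec_roundVar {ws : List (List Bool)} {v : List Bool} {m : Mem S a} {rest : List Bool}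
    (hm : m.sub S.out = ws.flatMap encStr ++ rest) (hO : O (ws.flatMap encStr) = v)
    (htmp : m.tmp = []) (hqry : m.qry = []) (hans : m.ans = []) :
    Exec O (roundVar S a ws.length) m {m with
      res := v.reverse ++ m.res
      sub := Function.update m.sub S.out rest}
      (4 * (ws.flatMap encStr).length + 2 * v.length + 3) := by
  refine ((exec_copyWords hm).seq ((Exec.move (by simp) (Mem.update_tmp _ _)
    (Mem.update_qry _ _)).seq (Exec.query.seq
      (Exec.move (by simp) (Mem.update_ans _ _) (Mem.update_res _ _))))).conv rfl ?_ ?_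
  · simp [Mem.store, htmp, hqry, hans, hO]
  · simp only [Mem.store, htmp, hqry, List.append_nil, List.length_reverse, List.reverse_reverse, hO]
    omega

/-- Round the values of all variables. -/
def roundAll (S : Machine) (a k : ℕ) : Prog S (Stk a) :=
  .loop (.inl .num) Option.isSome fun _ => roundVar S a k

/-- Each entry of `bs` belongs to one variable: the words of its `k` coordinates, and the oracle's
answer. The uniform bound `c` on the answers keeps the cost of handling them linear in the number of
variables. -/
theorem exec_roundAll {c : ℕ} {bs : List (List (List Bool) × List Bool)} {m : Mem S a}
    (hnum : m.num = List.replicate bs.length true)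
    (hm : m.sub S.out = bs.flatMap fun b => b.1.flatMap encStr)
    (hO : ∀ b ∈ bs, O (b.1.flatMap encStr) = b.2) (hk : ∀ b ∈ bs, b.1.length = k)
    (hc : ∀ b ∈ bs, b.2.length ≤ c)
    (htmp : m.tmp = []) (hqry : m.qry = []) (hans : m.ans = []) :
    Exec O (roundAll S a k) m {m with
      num := []
      res := (bs.flatMap fun b => b.2).reverse ++ m.res
      sub := Function.update m.sub S.out []}
      (4 * (m.sub S.out).length + bs.length * (2 * c + 4) + 1) := by
  induction bs generalizing m with
  | nil =>
    refine (Exec.loop_exit (Mem.update_num _ _) (by simp [Mem.store, hnum])).conv rfl ?_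
      (by omega)
    simp only [List.flatMap_nil] at hm
    rw [eq_comm]
    simp only [Mem.mk.injEq, true_and, Function.update_eq_self_iff]
    simp [Mem.store, hnum, hm]
  | cons b bs ih =>
    rw [List.flatMap_cons] at hm
    have hb := exec_roundVar (O := O) (m := {m with num := List.replicate bs.length true}) hm
      (hO b (by simp)) htmp hqry hans
    rw [hk b (by simp)] at hb
    have h2 := ih (m := {m with
      num := List.replicate bs.length true
      res := b.2.reverse ++ m.res
      sub := Function.update m.sub S.out (bs.flatMap fun b => b.1.flatMap encStr)}) rfl (by simp)
      (fun b hb => hO b (by simp [hb])) (fun b hb => hk b (by simp [hb]))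
      (fun b hb => hc b (by simp [hb])) htmp hqry hans
    refine (Exec.loop_step (m₁ := {m with num := List.replicate bs.length true}) ?_ ?_
      hb h2).conv rfl ?_ ?_
    · rw [Mem.update_num]
      simp [Mem.store, hnum]
    · simp [Mem.store, hnum, List.replicate_succ]
    · simp
    · have := hc b (by simp)
      simp only [Function.update_self, hm, List.length_append, List.length_cons]
      nlinarith

/-- Evaluate the output of the subroutine. -/
def finish (S : Machine) (a k : ℕ) : Prog S (Stk a) :=
  .case (.inr S.out) fun o =>
    if o = some true then .seq (roundAll S a k)
      (.seq (.move (.inl .res) (.inl .out)) (.push (.inl .out) true))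
    else .push (.inl .out) false

theorem exec_finish_false {m : Mem S a} (hm : m.sub S.out = [false]) (hout : m.out = []) :
    ∃ m', m'.out = [false] ∧ Exec O (finish S a k) m m' 2 := by
  refine ⟨_, ?_, Exec.case (Mem.update_sub _ _ _) (t := 1) (m' := {m with
    out := [false]
    sub := Function.update m.sub S.out []}) ?_⟩
  · rfl
  · simp only [Mem.store, hm, List.head?_cons, Option.some.injEq, Bool.false_eq_true, if_false]
    refine (Exec.push (Mem.update_out _ _)).conv rfl ?_ le_rfl
    simp [Mem.store, hout]

theorem exec_finish_true {c : ℕ} {bs : List (List (List Bool) × List Bool)} {m : Mem S a}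
    (hnum : m.num = List.replicate bs.length true)
    (hm : m.sub S.out = true :: bs.flatMap fun b => b.1.flatMap encStr)
    (hO : ∀ b ∈ bs, O (b.1.flatMap encStr) = b.2) (hk : ∀ b ∈ bs, b.1.length = k)
    (hc : ∀ b ∈ bs, b.2.length ≤ c) (hres : m.res = []) (hout : m.out = [])
    (htmp : m.tmp = []) (hqry : m.qry = []) (hans : m.ans = []) :
    ∃ m', m'.out = true :: (bs.flatMap fun b => b.2) ∧
      Exec O (finish S a k) m m' (4 * (m.sub S.out).length + bs.length * (4 * c + 4) + 4) := by
  have h1 := exec_roundAll (O := O) (m := {m with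
    sub := Function.update m.sub S.out (bs.flatMap fun b => b.1.flatMap encStr)}) hnum (by simp) hO hk hc htmp hqry hans
  have hlen : (bs.flatMap fun b => b.2).length ≤ bs.length * c := by
    rw [List.length_flatMap]
    have := List.sum_le_card_nsmul (bs.map fun b => b.2.length) c (by
      simp only [List.mem_map, forall_exists_index, and_imp, forall_apply_eq_imp_iff₂]
      exact hc)
    simpa using this
  refine ⟨_, ?_, (Exec.case (Mem.update_sub _ _ _) (t := 4 * (bs.flatMap fun b =>
    b.1.flatMap encStr).length + bs.length * (2 * c + 4) + 1 + (2 * (bs.length * c) + 1 + 1))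
    (m' := {m with
      num := []
      res := []
      out := true :: (bs.flatMap fun b => b.2)
      sub := Function.update m.sub S.out []}) ?_).mono ?_⟩
  · rfl
  · simp only [Mem.store, hm, List.head?_cons, if_true, List.tail_cons]
    refine (h1.seq ((Exec.move (by simp) (Mem.update_res _ _) (Mem.update_out _ _)).seq
      (Exec.push (Mem.update_out _ _)))).conv rfl ?_ ?_
    · simp [Mem.store, hres, hout]
    · simp only [Mem.store, hres, List.append_nil, List.length_reverse, Function.update_self]
      omega
  · rw [hm, List.length_cons]
    nlinarith

end Rounding

/-! ### The complete algorithm and its running time. -/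

namespace PromiseTemplate

variable {I D E : Type*} [Fintype I] {k a : ℕ} (Γ : PromiseTemplate I D E) (S : Machine)
  (p₀ : Fin a) (LD : List (Ineq (Fin 1 × Fin k))) (L : ∀ i, List (Ineq (Fin (Γ.ar i) × Fin k)))

/-- Read a formula and produce the rows of the integer system. -/
noncomputable def collect : Prog S (Stk a) :=
  .seq (readNum S a) (.seq (domainProg S p₀ LD) (constraintsProg S a L))

variable {p₀}

theorem exec_collect (hp : p₀.1 = 0) (ha : ∀ i, Γ.ar i ≤ a) :
    ∃ T, ∀ (O : Oracle) (Ψ : Formula Γ.ar), Exec O (Γ.collect S p₀ LD L) (Mem.init S a Ψ.encode)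
      {Mem.init S a [] with
        num := List.replicate Ψ.n true
        rows := ((Γ.rows LD L Ψ).flatMap encRow).reverse
        cnt := List.replicate (Γ.rows LD L Ψ).length true}
      (T * (Ψ.encode.length + 1) ^ 2) := by
  obtain ⟨T₁, h₁⟩ := exec_domainProg S hp LD
  obtain ⟨T₂, h₂⟩ := exec_constraintsProg S ha L
  refine ⟨T₁ + T₂ + 4, fun O Ψ => ?_⟩
  have hr := exec_readNum (O := O) (m := Mem.init S a Ψ.encode) (n := Ψ.n)
    (rest := encConstraints Ψ.constraints ++ [false])
    (by simp [Mem.init, Formula.encode, encConstraints]) rfl rfl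
  have hd := h₁ O {Mem.init S a (encConstraints Ψ.constraints ++ [false]) with
    num := List.replicate Ψ.n true
    idx := List.replicate Ψ.n true} Ψ.n rfl rfl rfl rfl rfl
  have hc := h₂ O Ψ.n Ψ.constraints {Mem.init S a (encConstraints Ψ.constraints ++ [false]) with
    num := List.replicate Ψ.n true
    rows := (((List.range Ψ.n).flatMap fun i => rowsAt Ψ.n LD fun _ => i).flatMap encRow).reverse
    cnt := List.replicate ((List.range Ψ.n).flatMap fun i => rowsAt Ψ.n LD fun _ => i).length true}
    rfl rfl rfl rfl rfl
  refine (hr.seq ((hd.conv rfl ?_ le_rfl).seq hc)).conv rfl ?_ ?_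
  · simp [Mem.init]
  · simp only [Mem.mk.injEq, Mem.init, true_and, and_true]
    refine ⟨?_, ?_⟩
    · rw [List.replicate_append_replicate, rows, List.length_append, add_comm]
    · rw [rows, List.flatMap_append, List.reverse_append]
  -- The variables are counted in unary and every constraint has its own marker bit, so both numbers
  -- are at most the length of the code.
  · have hn : Ψ.n ≤ Ψ.encode.length := by simp [Formula.encode, encNat]
    have hcs : Ψ.constraints.length ≤ Ψ.encode.length := by
      have : Ψ.constraints.length ≤ (encConstraints Ψ.constraints).length := by
        simp [encConstraints, List.length_flatMap]
      refine this.trans ?_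
      simp [Formula.encode, encConstraints]
      omega
    generalize Ψ.encode.length = N at hn hcs
    have e1 : T₁ * (Ψ.n + 1) * (Ψ.n + 1) ≤ T₁ * (N + 1) * (N + 1) := by gcongr
    have e2 : Ψ.constraints.length * (T₂ * (Ψ.n + 1)) ≤ N * (T₂ * (N + 1)) := by gcongr
    nlinarith [Nat.zero_le (T₂ * N), Nat.zero_le (N * N)]

/-- The rounding algorithm. -/
noncomputable def roundLP : Prog S (Stk a) :=
  .seq (Γ.collect S p₀ LD L) (.seq (assemble S a k) (.seq .run (finish S a k)))

end PromiseTemplate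

theorem eval_le_eval (p : Polynomial ℕ) {m n : ℕ} (h : m ≤ n) : p.eval m ≤ p.eval n := by
  rw [Polynomial.eval_eq_sum_range, Polynomial.eval_eq_sum_range]
  gcongr

theorem length_encFin_le {E : Type*} [Fintype E] (e : E) : (encFin e).length ≤ Fintype.card E := by
  simp [encFin, encNat]

/-- The solver's output is already the concatenation of the oracle queries for the individual
variables. -/
theorem BitRep.encTuple_eq_flatMap {A : Subring ℝ} (ρ : BitRep A) {n k : ℕ}
    (x : Fin (n * k) → ρ.Word) :
    ρ.encTuple x = (List.ofFn fun i => ρ.encTuple (points x i)).flatten := by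
  rw [encTuple, List.ofFn_mul, List.flatMap, List.map_flatten, List.flatten_flatten, List.map_ofFn,
    List.map_ofFn]
  congr 2
  funext i
  simp only [Function.comp, encTuple, List.flatMap]
  congr 3
  funext c
  rw [points]
  congr 1
  ext
  simp [finProdFinEquiv]
  ring

open PromiseTemplate in
/-- The Basic LP can be rounded in polynomial time with oracle access to the rounding map. -/
theorem LPSolvable.oraclePolyTime_roundedBasicLP {I D E : Type*} [Fintype I] [Finite D] [Fintype E]
    {A : Subring ℝ} {ρ : BitRep A} (hA : LPSolvable ρ) (Γ : PromiseTemplate I D E) {k : ℕ}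
    (g : D → Fin k → ℤ) (h : (Fin k → A) → E) :
    OraclePolyTime (oraclesFor ρ h) Formula.encode (Γ.RoundedBasicLP A g h) := by
  obtain ⟨S, q, hS, hsolve⟩ := hA.solve
  obtain ⟨LD, L, hL⟩ := Γ.exists_inequalities g
  -- Large enough for all arities, and positive, so that the position `p₀` exists even if there are
  -- no symbols of positive arity.
  let a := ∑ i, Γ.ar i + 1
  have ha : ∀ i, Γ.ar i ≤ a := fun i =>
    (Finset.single_le_sum (f := Γ.ar) (fun _ _ => Nat.zero_le _) (Finset.mem_univ i)).trans
      (Nat.le_succ _)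
  let p₀ : Fin a := ⟨0, Nat.succ_pos _⟩
  obtain ⟨T, hT⟩ := Γ.exec_collect S (p₀ := p₀) LD L rfl ha
  let c := Fintype.card E
  -- `B` bounds the time for collecting the rows, `Z` the size of the integer system, and `Y` the
  -- size of the solver's output.
  let B : Polynomial ℕ := .C T * (.X + 1) ^ 2
  let Z : Polynomial ℕ := 2 * B + .X * .C k + 2
  let Y : Polynomial ℕ := Z + q.comp Z
  refine ⟨(Γ.roundLP S (p₀ := p₀) LD L).toMachine (.inp, .out) (.qry, .ans),
    B + (4 * B + .X * .C (k + 4) + 6) + q.comp Z + (4 * Y + .X * .C (4 * c + 4) + 4),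
    fun O hO Ψ => ?_⟩
  have h1 := hT O Ψ
  -- The rows do not depend on the oracle, so their running time with empty answers also bounds
  -- their total length and their number.
  have hsize := Prog.Runs.length_le (hT (fun _ => []) Ψ)
  set N := Ψ.encode.length with hN
  have hn : Ψ.n ≤ N := by simp [hN, Formula.encode, encNat]
  have hB : B.eval N = T * (N + 1) ^ 2 := by simp [B]
  rw [← hB] at h1 hsize
  let R := Γ.rows LD L Ψ
  let w := R.flatMap encRow
  have hw : w.length ≤ B.eval N := by
    have := hsize (.inl .rows)
    simp only [Mem.store, Mem.init, List.length_reverse, List.length_nil, Nat.zero_add] at this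
    exact this
  have hr : R.length ≤ B.eval N := by
    have := hsize (.inl .cnt)
    simpa [Mem.store, Mem.init] using this
  have hZ : Z.eval N = 2 * B.eval N + N * k + 2 := by simp [Z]
  obtain ⟨y, hy, hsol⟩ := hsolve (IntSystem.ofRows R)
  have hx : (IntSystem.ofRows R).encode.length ≤ Z.eval N := by
    rw [IntSystem.encode_ofRows, hZ]
    simp only [List.length_append, encNat, List.length_replicate, List.length_singleton]
    have := Nat.mul_le_mul_right k hn
    change R.length + 1 + (Ψ.n * k + 1) + w.length ≤ _
    omega
  have hyl : y.length ≤ Y.eval N := by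
    refine hy.length_le.trans ?_
    simp only [Y, Polynomial.eval_add, Polynomial.eval_comp]
    exact Nat.add_le_add hx (eval_le_eval q hx)
  have h2 := exec_assemble (S := S) (a := a) (k := k) O (m := {Mem.init S a [] with
    num := List.replicate Ψ.n true
    rows := w.reverse
    cnt := List.replicate R.length true}) rfl rfl rfl rfl rfl
  obtain ⟨σ, hσ, h3⟩ := Exec.run (O := O) hS (m := {Mem.init S a [] with
    num := List.replicate Ψ.n true
    sub := Function.update (fun _ => []) S.inp (encNat R.length ++ encNat (Ψ.n * k) ++ w)})
    rfl (by rw [← IntSystem.encode_ofRows]; exact hy)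
  suffices hfin : ∃ m', Γ.RoundedBasicLP A g h Ψ m'.out ∧ Exec O (finish S a k)
      {Mem.init S a [] with num := List.replicate Ψ.n true, sub := σ} m'
      (4 * y.length + Ψ.n * (4 * c + 4) + 4) by
    obtain ⟨m', hm', h4⟩ := hfin
    refine ⟨m'.out, Exec.outputs ((h1.seq (h2.seq (h3.seq h4))).mono ?_), hm'⟩
    simp only [Polynomial.eval_add, Polynomial.eval_mul, Polynomial.eval_X, Polynomial.eval_C,
      Polynomial.eval_ofNat, Polynomial.eval_comp]
    have e1 := eval_le_eval q hx
    have e2 := Nat.mul_le_mul_right (k + 4) hn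
    have e3 := Nat.mul_le_mul_right (4 * c + 4) hn
    omega
  rcases hsol with ⟨x, hx', rfl⟩ | ⟨hno, rfl⟩
  · change Fin (Ψ.n * k) → ρ.Word at x
    have henc : ∀ z : Fin k → ρ.Word,
        (List.ofFn fun c => ((z c).1 : List Bool)).flatMap encStr = ρ.encTuple z := by
      intro z
      simp only [BitRep.encTuple, List.flatMap, List.map_ofFn]
      rfl
    have hbs : (true :: ρ.encTuple x) = true :: (List.ofFn fun i : Fin Ψ.n =>
        ((List.ofFn fun c => ((points x i c).1 : List Bool)),
          encFin (h fun c => ρ.val (points x i c)))).flatMap fun b => b.1.flatMap encStr := by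
      rw [ρ.encTuple_eq_flatMap]
      simp only [List.flatMap, List.map_ofFn, Function.comp_def]
      simp only [← henc, List.flatMap, List.map_ofFn, Function.comp_def]
    obtain ⟨m', hm', h4⟩ := exec_finish_true (O := O) (k := k) (c := c)
      (m := {Mem.init S a [] with num := List.replicate Ψ.n true, sub := σ})
      (bs := List.ofFn fun i : Fin Ψ.n => ((List.ofFn fun c => ((points x i c).1 : List Bool)),
        encFin (h fun c => ρ.val (points x i c))))
      (by simp) (hσ.trans hbs) (by
        simp only [List.forall_mem_ofFn_iff, henc]
        exact fun i => hO _) (by simp) (by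
        simp only [List.forall_mem_ofFn_iff]
        exact fun i => length_encFin_le _) rfl rfl rfl rfl rfl
    refine ⟨m', ?_, h4.mono (le_of_eq (by simp [hσ]))⟩
    refine Or.inl ⟨fun i c => ρ.val (points x i c), ?_, ?_⟩
    · exact (hL A Ψ _).1 hx'
    · rw [hm']
      simp only [List.flatMap, List.map_ofFn, Function.comp_def, Formula.encAssignment]
  · obtain ⟨m', hm', h4⟩ := exec_finish_false (O := O) (k := k)
      (m := {Mem.init S a [] with num := List.replicate Ψ.n true, sub := σ}) hσ rfl
    refine ⟨m', Or.inr ⟨?_, hm'⟩, h4.mono (by omega)⟩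
    rintro ⟨v, hv⟩
    -- A solution of the Basic LP, flattened to a single tuple, would solve the system that the
    -- solver reported as infeasible.
    refine hno ⟨fun j => v (finProdFinEquiv.symm j).1 (finProdFinEquiv.symm j).2, (hL A Ψ _).2 ?_⟩
    convert hv using 1
    funext i c
    simp [points]

end PromiseCSP

theorem mainTheorem10 {I D E : Type*} [Fintype I] [Fintype D] [Fintype E]
    (A : Subring ℝ) (ρ : PromiseCSP.BitRep A) (hA : PromiseCSP.LPSolvable ρ)
    (Γ : PromiseCSP.PromiseTemplate I D E) (k : ℕ) (hk : 1 ≤ k)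
    (g : D → Fin k → ℤ) (h : (Fin k → A) → E) (hgh : Γ.SandwichesLP A g h) :
    Γ.PCSP ∈ PromiseCSP.OracleP (PromiseCSP.oraclesFor ρ h) ∧
    PromiseCSP.OraclePolyTime (PromiseCSP.oraclesFor ρ h) PromiseCSP.Formula.encode Γ.SearchPCSP ∧
    PromiseCSP.OraclePolyTime (PromiseCSP.oraclesFor ρ h) PromiseCSP.Formula.encode
      (Γ.RoundedBasicLP A g h) := by
  have ho := hA.oraclePolyTime_roundedBasicLP Γ g h
  refine ⟨PromiseCSP.PromiseTemplate.pcsp_mem_oracleP hgh ho, ?_, ho⟩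
  obtain ⟨M, p, hM⟩ := ho
  refine ⟨M, p, fun O hO Ψ => ?_⟩
  obtain ⟨y, hy, hr⟩ := hM O hO Ψ
  exact ⟨y, hy, hr.searchPCSP hgh⟩
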